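/- Conventions. All manifolds, forms and maps are $C^\infty$. A (co-oriented) contact structure $\xi$ on a 3-manifold $V$ is a co-oriented plane field of the form $\xi=\ker\lambda$, where $\lambda$ is a 1-form, positive on the positive side of $\xi$, with $\lambda\wedge d\lambda$ nowhere zero. Any such $\lambda$ orients $V$ by $\lambda\wedge d\lambda$ (the contact orientation) and $\xi$ by $d\lambda|_\xi$; these orientations do not depend on $\lambda$. A symplectic 4-manifold $(W,\omega)$ is oriented by $\omega\wedge\omega$, and $\partial W$ carries the boundary orientation (outward normal first). Let $W$ be a compact 4-manifold with boundary $\partial W=V$, let $\xi$ be a contact structure on $V$ as above, and let $\omega$ be a symplectic form on $W$ for which the boundary orientation of $\partial W$ is the contact orientation of $(V,\xi)$. - $(W,\omega)$ is a *weak symplectic filling* of $(V,\xi)$ if $\omega|_\xi>0$. - $(W,\omega)$ is a *strong symplectic filling* of $(V,\xi)$ if on some neighbourhood of $\partial W$ there is a 1-form $\alpha$ with $d\alpha=\omega$ such that $\xi=\{\alpha|_V=0\}$ and $d\alpha|_\xi>0$. **Proposition.** Suppose that $(W,\omega)$ is a weak symplectic filling of $(V,\xi)$ and that $\omega$ is exact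 near $\partial W$, i.e. $\omega=d\alpha$ on some neighbourhood of $\partial W$ for a 1-form $\alpha$ defined there. Then $\omega$ can be modified near the boundary into a symplectic form $\widetilde\omega$ which makes $W$ a strong filling: for every open neighbourhood $U$ of $\partial W$ there is a symplectic form $\widetilde\omega$ on $W$ that coincides with $\omega$ on $W\setminus U$ and such that $(W,\widetilde\omega)$ is a strong symplectic filling of $(V,\xi)$. -/

import Mathlib

open Set
open scoped Manifold ContDiff Topology

noncomputable section

namespace SymplecticFilling

section Forms

variable {E H : Type*} [NormedAddCommGroup E] [NormedSpace ℝ E] [TopologicalSpace H]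
  (I : ModelWithCorners ℝ E H) {M : Type*} [TopologicalSpace M] [ChartedSpace H M]

variable (M) in
/-- A (not necessarily continuous) differential `k`-form on the manifold `M`: an alternating
`k`-linear form on every tangent space. -/
abbrev DForm (k : ℕ) : Type _ := ∀ x : M, (TangentSpace I x) [⋀^Fin k]→L[ℝ] ℝ

variable {I}

/-- The expression of a form in the preferred chart around `x₀`, i.e. its pull-back by the inverse
chart, as a form on the model vector space (meaningful on the target of the extended chart). -/
def DForm.inChart {k : ℕ} (σ : DForm I M k) (x₀ : M) : E → E [⋀^Fin k]→L[ℝ] ℝ := fun y =>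
  (σ ((extChartAt I x₀).symm y)).compContinuousLinearMap
    (mfderivWithin 𝓘(ℝ, E) I (extChartAt I x₀).symm (range I) y :
      E →L[ℝ] TangentSpace I ((extChartAt I x₀).symm y))

/-- `σ` is `C^∞` (up to the boundary of `M`, if there is one) on the open set `U`: all its
expressions in charts are. -/
def DForm.SmoothOn {k : ℕ} (σ : DForm I M k) (U : Set M) : Prop :=
  ∀ x₀ : M, ContDiffOn ℝ ∞ (σ.inChart x₀)
    ((extChartAt I x₀).target ∩ (extChartAt I x₀).symm ⁻¹' U)

/-- `σ` is a `C^∞` form on `M`. -/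
def DForm.Smooth {k : ℕ} (σ : DForm I M k) : Prop := σ.SmoothOn univ

/-- The exterior derivative: at `x`, take the exterior derivative of the expression of the form in
the chart around `x`, and pull it back by the chart. -/
def DForm.d {k : ℕ} (σ : DForm I M k) : DForm I M (k + 1) := fun x =>
  (extDerivWithin (σ.inChart x) (range I) (extChartAt I x x)).compContinuousLinearMap
    (mfderiv I 𝓘(ℝ, E) (extChartAt I x) x : TangentSpace I x →L[ℝ] E)

/-- The value `(α ∧ β)(a, b, c)` of the wedge product of a 1-form and a 2-form. -/
def wedge12 (α : DForm I M 1) (β : DForm I M 2) (x : M) (a b c : TangentSpace I x) : ℝ :=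
  α x ![a] * β x ![b, c] - α x ![b] * β x ![a, c] + α x ![c] * β x ![a, b]

/-- The value `(σ ∧ σ)(a, b, c, e)` of the wedge square of a 2-form. -/
def wedgeSq (σ : DForm I M 2) (x : M) (a b c e : TangentSpace I x) : ℝ :=
  2 * (σ x ![a, b] * σ x ![c, e] - σ x ![a, c] * σ x ![b, e] + σ x ![a, e] * σ x ![b, c])

/-- A symplectic form: a smooth closed non-degenerate 2-form. -/
structure IsSymplecticForm (σ : DForm I M 2) : Prop where
  smooth : σ.Smooth
  closed : ∀ x, σ.d x = 0
  nondegenerate : ∀ (x : M) (v : TangentSpace I x),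
    (∀ w : TangentSpace I x, σ x ![v, w] = 0) → v = 0

/-- `α` is a smooth primitive of `σ` on `U`. -/
def IsPrimitiveOn (α : DForm I M 1) (σ : DForm I M 2) (U : Set M) : Prop :=
  α.SmoothOn U ∧ ∀ x ∈ U, α.d x = σ x

/-- `σ` is exact near the boundary of `M`. -/
def ExactNearBoundary (σ : DForm I M 2) : Prop :=
  ∃ U : Set M, IsOpen U ∧ I.boundary M ⊆ U ∧ ∃ α : DForm I M 1, IsPrimitiveOn α σ U

end Forms

section Contact

variable {V : Type*} [TopologicalSpace V] [ChartedSpace (EuclideanSpace ℝ (Fin 3)) V]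

/-- A contact form on a 3-manifold: a smooth 1-form `lam` with `lam ∧ d lam` nowhere zero. -/
structure IsContactForm (lam : DForm (𝓡 3) V 1) : Prop where
  smooth : lam.Smooth
  nondegenerate : ∀ x : V, ∃ a b c : TangentSpace (𝓡 3) x, wedge12 lam lam.d x a b c ≠ 0

variable (V) in
/-- A co-oriented contact structure on a 3-manifold `V`: the field `plane` of tangent planes,
together with the choice of one of the two sides of each plane, which can be given as
`plane = {lam = 0}`, `posSide = {lam > 0}` for a contact form `lam`. -/
structure ContactStructure where
  plane : ∀ x : V, Submodule ℝ (TangentSpace (𝓡 3) x)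
  posSide : ∀ x : V, Set (TangentSpace (𝓡 3) x)
  exists_form : ∃ lam : DForm (𝓡 3) V 1, IsContactForm lam ∧
    (∀ x v, v ∈ plane x ↔ lam x ![v] = 0) ∧ (∀ x v, v ∈ posSide x ↔ 0 < lam x ![v])

/-- `lam` is a contact form defining `ξ` and its co-orientation. -/
def ContactStructure.IsDefinedBy (ξ : ContactStructure V) (lam : DForm (𝓡 3) V 1) : Prop :=
  IsContactForm lam ∧
    (∀ x v, v ∈ ξ.plane x ↔ lam x ![v] = 0) ∧ (∀ x v, v ∈ ξ.posSide x ↔ 0 < lam x ![v])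

/-- `(u, v)` is a basis of the plane `ξ x`, positive for the orientation of `ξ`, that is, the one
given by `d lam` for any form `lam` that defines the co-oriented `ξ`. -/
def ContactStructure.PosFrame (ξ : ContactStructure V) (x : V) (u v : TangentSpace (𝓡 3) x) :
    Prop :=
  u ∈ ξ.plane x ∧ v ∈ ξ.plane x ∧
    ∃ lam : DForm (𝓡 3) V 1, ξ.IsDefinedBy lam ∧ 0 < lam.d x ![u, v]

/-- `(a, b, c)` is a basis of `T_x V`, positive for the contact orientation of `V`, that is, the one
given by `lam ∧ d lam` for any form `lam` that defines `ξ`. -/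
def ContactStructure.PosBasis (ξ : ContactStructure V) (x : V) (a b c : TangentSpace (𝓡 3) x) :
    Prop :=
  ∃ lam : DForm (𝓡 3) V 1, ξ.IsDefinedBy lam ∧ 0 < wedge12 lam lam.d x a b c

end Contact

section Filling

variable {W : Type*} [TopologicalSpace W] [ChartedSpace (EuclideanHalfSpace 4) W]
  {V : Type*} [TopologicalSpace V] [ChartedSpace (EuclideanSpace ℝ (Fin 3)) V]

/-- A tangent vector at a boundary point `p` of `W` which points out of `W`; the model space of `W`
is the half-space `0 ≤ y 0`. -/
def IsOutward (p : W) (v : TangentSpace (𝓡∂ 4) p) : Prop :=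
  NormedSpace.fromTangentSpace (𝕜 := ℝ) (extChartAt (𝓡∂ 4) p p)
    (mfderiv (𝓡∂ 4) 𝓘(ℝ, EuclideanSpace ℝ (Fin 4)) (extChartAt (𝓡∂ 4) p) p v) 0 < 0

/-- `ι` identifies the manifold `V` with the boundary of `W`: it is a smooth embedding with image
`∂W`. -/
structure IsBoundaryInclusion (ι : V → W) : Prop where
  smooth : ContMDiff (𝓡 3) (𝓡∂ 4) ∞ ι
  embedding : Topology.IsEmbedding ι
  immersion : ∀ x : V, Function.Injective (mfderiv (𝓡 3) (𝓡∂ 4) ι x)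
  range_eq : range ι = (𝓡∂ 4).boundary W

/-- Via `ι`, the contact orientation of `(V, ξ)` is the orientation of `∂W` as the boundary
(outward normal first) of `W` with its symplectic orientation `σ ∧ σ`. -/
def OrientationsAgree (σ : DForm (𝓡∂ 4) W 2) (ι : V → W) (ξ : ContactStructure V) : Prop :=
  ∀ (x : V) (n : TangentSpace (𝓡∂ 4) (ι x)) (a b c : TangentSpace (𝓡 3) x),
    IsOutward (ι x) n → ξ.PosBasis x a b c →
      0 < wedgeSq σ (ι x) n (mfderiv (𝓡 3) (𝓡∂ 4) ι x a) (mfderiv (𝓡 3) (𝓡∂ 4) ι x b)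
        (mfderiv (𝓡 3) (𝓡∂ 4) ι x c)

/-- The 2-form `β` on `W` is positive on the oriented planes `ξ ⊆ TV = T(∂W)`. -/
def PositiveOn (β : DForm (𝓡∂ 4) W 2) (ι : V → W) (ξ : ContactStructure V) : Prop :=
  ∀ (x : V) (u v : TangentSpace (𝓡 3) x), ξ.PosFrame x u v →
    0 < β (ι x) ![mfderiv (𝓡 3) (𝓡∂ 4) ι x u, mfderiv (𝓡 3) (𝓡∂ 4) ι x v]

/-- `(W, σ)` is a weak symplectic filling of `(V, ξ)`, where `V = ∂W` via `ι`. -/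
structure IsWeakFilling (σ : DForm (𝓡∂ 4) W 2) (ι : V → W) (ξ : ContactStructure V) : Prop where
  symplectic : IsSymplecticForm σ
  boundary : IsBoundaryInclusion ι
  orientation : OrientationsAgree σ ι ξ
  positive : PositiveOn σ ι ξ

/-- `(W, σ)` is a strong symplectic filling of `(V, ξ)`, where `V = ∂W` via `ι`: near the boundary
`σ` has a primitive `α` with `ξ = {α|_V = 0}` and `dα|_ξ > 0`. -/
structure IsStrongFilling (σ : DForm (𝓡∂ 4) W 2) (ι : V → W) (ξ : ContactStructure V) :
    Prop where
  symplectic : IsSymplecticForm σ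
  boundary : IsBoundaryInclusion ι
  orientation : OrientationsAgree σ ι ξ
  primitive : ∃ U : Set W, IsOpen U ∧ (𝓡∂ 4).boundary W ⊆ U ∧
    ∃ α : DForm (𝓡∂ 4) W 1, IsPrimitiveOn α σ U ∧
      (∀ (x : V) (v : TangentSpace (𝓡 3) x),
        v ∈ ξ.plane x ↔ α (ι x) ![mfderiv (𝓡 3) (𝓡∂ 4) ι x v] = 0) ∧
      PositiveOn α.d ι ξ

end Filling

end SymplecticFilling

end

noncomputable section

namespace SymplecticFilling

section FormCalculus

variable {E H : Type*} [NormedAddCommGroup E] [NormedSpace ℝ E] [TopologicalSpace H]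
  {I : ModelWithCorners ℝ E H} {M : Type*} [TopologicalSpace M] [ChartedSpace H M]
  {E' H' : Type*} [NormedAddCommGroup E'] [NormedSpace ℝ E'] [TopologicalSpace H']
  {J : ModelWithCorners ℝ E' H'} {N : Type*} [TopologicalSpace N] [ChartedSpace H' N]
  {k : ℕ}

/-- The pull-back of a form by a map. -/
def DForm.pullback (f : M → N) (σ : DForm J N k) : DForm I M k := fun x =>
  (σ (f x)).compContinuousLinearMap (mfderiv I J f x)

/-- Smoothness of a form at a point, read in the preferred chart there. -/
def DForm.SmoothAt (σ : DForm I M k) (x : M) : Prop :=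
  ContDiffWithinAt ℝ ∞ (σ.inChart x) (range I) (extChartAt I x x)

theorem DForm.inChart_apply (σ : DForm I M k) (x₀ : M) (y : E) (v : Fin k → E) :
    σ.inChart x₀ y v = σ ((extChartAt I x₀).symm y)
      (fun i => mfderivWithin 𝓘(ℝ, E) I (extChartAt I x₀).symm (range I) y (v i)) := rfl

theorem DForm.pullback_apply (f : M → N) (σ : DForm J N k) (x : M)
    (v : Fin k → TangentSpace I x) :
    DForm.pullback (I := I) f σ x v = σ (f x) (fun i => mfderiv I J f x (v i)) := rfl

theorem DForm.apply_congr_point (σ : DForm I M k) {p q : M} (h : p = q) (v w : Fin k → E)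
    (hvw : v = w) : (σ p : E [⋀^Fin k]→L[ℝ] ℝ) v = (σ q : E [⋀^Fin k]→L[ℝ] ℝ) w := by
  subst h hvw; rfl

theorem mfderivWithin_comp_chart [IsManifold I ∞ M] [IsManifold J ∞ N] {f : M → N} {x₁ : M}
    {z₁ : N} {y : E}
    (hy : y ∈ (extChartAt I x₁).target)
    (hf : MDifferentiableAt I J f ((extChartAt I x₁).symm y))
    (hz : f ((extChartAt I x₁).symm y) ∈ (extChartAt J z₁).source) (v : E) :
    (mfderiv I J f ((extChartAt I x₁).symm y)
      (mfderivWithin 𝓘(ℝ, E) I (extChartAt I x₁).symm (range I) y v) : E') =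
    mfderivWithin 𝓘(ℝ, E') J (extChartAt J z₁).symm (range J)
      ((extChartAt J z₁) (f ((extChartAt I x₁).symm y)))
      (fderivWithin ℝ (fun y => extChartAt J z₁ (f ((extChartAt I x₁).symm y))) (range I) y v) := by
  have : IsManifold I 1 M := .of_le (n := ∞) (by simp)
  have : IsManifold J 1 N := .of_le (n := ∞) (by simp)
  have hyr : y ∈ range I := extChartAt_target_subset_range x₁ hy
  have U : UniqueMDiffWithinAt 𝓘(ℝ, E) (range I) y := I.uniqueMDiffOn _ hyr
  have hs := mdifferentiableWithinAt_extChartAt_symm (I := I) hy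
  have h1 : MDifferentiableWithinAt 𝓘(ℝ, E) J (f ∘ (extChartAt I x₁).symm) (range I) y :=
    hf.comp_mdifferentiableWithinAt y hs
  have hz' : f ((extChartAt I x₁).symm y) ∈ (chartAt H' z₁).source := by
    rwa [← extChartAt_source (I := J)]
  have hg : MDifferentiableAt J 𝓘(ℝ, E') (extChartAt J z₁) (f ((extChartAt I x₁).symm y)) :=
    mdifferentiableAt_extChartAt hz'
  have h2 : MDifferentiableWithinAt 𝓘(ℝ, E) 𝓘(ℝ, E')
      (extChartAt J z₁ ∘ (f ∘ (extChartAt I x₁).symm)) (range I) y :=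
    MDifferentiableAt.comp_mdifferentiableWithinAt y hg h1
  have e1 : mfderivWithin 𝓘(ℝ, E) J (f ∘ (extChartAt I x₁).symm) (range I) y = _ :=
    mfderiv_comp_mfderivWithin y hf hs U
  have e2 : mfderivWithin 𝓘(ℝ, E) 𝓘(ℝ, E') (extChartAt J z₁ ∘ (f ∘ (extChartAt I x₁).symm))
      (range I) y = _ := mfderiv_comp_mfderivWithin y hg h1 U
  have e3 := mfderivWithin_extChartAt_symm_comp_mfderiv_extChartAt' (I := J) hz
  have e4 := mfderivWithin_eq_fderivWithin (𝕜 := ℝ)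
    (f := extChartAt J z₁ ∘ (f ∘ (extChartAt I x₁).symm)) (s := range I) (x := y)
  have e5 : fderivWithin ℝ (fun y => extChartAt J z₁ (f ((extChartAt I x₁).symm y))) (range I) y v
    = mfderiv J 𝓘(ℝ, E') (extChartAt J z₁) (f ((extChartAt I x₁).symm y))
      (mfderiv I J f ((extChartAt I x₁).symm y)
      (mfderivWithin 𝓘(ℝ, E) I (extChartAt I x₁).symm (range I) y v)) := by
    have := congrArg (fun L : E →L[ℝ] E' => L v) (e4.symm.trans (e2.trans (by rw [e1])))
    exact this
  rw [e5]
  exact (congrArg (fun L : E' →L[ℝ] E' => L (mfderiv I J f ((extChartAt I x₁).symm y)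
      (mfderivWithin 𝓘(ℝ, E) I (extChartAt I x₁).symm (range I) y v))) e3).symm

theorem DForm.inChart_pullback [IsManifold I ∞ M] [IsManifold J ∞ N] (σ : DForm J N k)
    {f : M → N} {x₁ : M} {z₁ : N} {y : E}
    (hy : y ∈ (extChartAt I x₁).target)
    (hf : MDifferentiableAt I J f ((extChartAt I x₁).symm y))
    (hz : f ((extChartAt I x₁).symm y) ∈ (extChartAt J z₁).source) :
    (DForm.pullback (I := I) f σ).inChart x₁ y =
      (σ.inChart z₁ (extChartAt J z₁ (f ((extChartAt I x₁).symm y)))).compContinuousLinearMap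
        (fderivWithin ℝ (fun y => extChartAt J z₁ (f ((extChartAt I x₁).symm y))) (range I) y) := by
  ext v
  refine DForm.apply_congr_point σ ((extChartAt J z₁).left_inv hz).symm _ _ ?_
  funext i
  exact mfderivWithin_comp_chart hy hf hz (v i)

variable (E k) in
/-- A continuous linear left inverse, up to the factor `k!`, of the inclusion of the alternating
maps into the multilinear ones. -/
def alternatizationCLM :
    ContinuousMultilinearMap ℝ (fun _ : Fin k => E) ℝ →L[ℝ] E [⋀^Fin k]→L[ℝ] ℝ :=
  LinearMap.mkContinuous
    { toFun := fun f => ContinuousMultilinearMap.alternatization f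
      map_add' := map_add _
      map_smul' := fun c f => by
        ext v
        simp [ContinuousMultilinearMap.alternatization_apply_apply, Finset.mul_sum, mul_left_comm,
          Units.smul_def] }
    (Fintype.card (Equiv.Perm (Fin k))) (fun f => by
      refine ContinuousAlternatingMap.opNorm_le_bound _ (by positivity) fun v => ?_
      change ‖ContinuousMultilinearMap.alternatization f v‖ ≤ _
      rw [ContinuousMultilinearMap.alternatization_apply_apply]
      refine (norm_sum_le _ _).trans ?_
      rw [mul_assoc, ← nsmul_eq_mul, ← Finset.card_univ]
      refine Finset.sum_le_card_nsmul _ _ _ fun τ _ => ?_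
      have h1 : ‖Equiv.Perm.sign τ • f (v ∘ τ)‖ = ‖f (v ∘ τ)‖ := by
        rcases Int.units_eq_one_or (Equiv.Perm.sign τ) with h | h <;> simp [h]
      rw [h1]
      refine (f.le_opNorm _).trans_eq ?_
      congr 1
      exact Equiv.prod_comp τ fun i => ‖v i‖)

theorem alternatizationCLM_toContinuousMultilinearMap (θ : E [⋀^Fin k]→L[ℝ] ℝ) :
    alternatizationCLM E k θ.toContinuousMultilinearMap = (k.factorial : ℝ) • θ := by
  ext v
  have := congrArg (fun g : E [⋀^Fin k]→ₗ[ℝ] ℝ => g v)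
    (AlternatingMap.coe_alternatization θ.toAlternatingMap)
  simp only [AlternatingMap.smul_apply, Fintype.card_fin] at this
  change ContinuousMultilinearMap.alternatization θ.toContinuousMultilinearMap v = _
  rw [ContinuousMultilinearMap.alternatization_apply_apply]
  rw [MultilinearMap.alternatization_apply] at this
  simpa [Function.comp_def] using this

theorem contDiffWithinAt_compContinuousLinearMap {X : Type*} [NormedAddCommGroup X]
    [NormedSpace ℝ X] {n : WithTop ℕ∞} {θ : X → E' [⋀^Fin k]→L[ℝ] ℝ} {L : X → E →L[ℝ] E'}
    {s : Set X} {x : X} (hθ : ContDiffWithinAt ℝ n θ s x) (hL : ContDiffWithinAt ℝ n L s x) :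
    ContDiffWithinAt ℝ n (fun y => (θ y).compContinuousLinearMap (L y)) s x := by
  have h1 : ContDiffWithinAt ℝ n (fun y =>
      ContinuousMultilinearMap.compContinuousLinearMapContinuousMultilinear ℝ
        (fun _ : Fin k => E) (fun _ : Fin k => E') ℝ (fun _ => L y)) s x :=
    (ContinuousMultilinearMap.contDiff _).contDiffAt.comp_contDiffWithinAt x
      (contDiffWithinAt_pi.2 fun _ => hL)
  let T : E' [⋀^Fin k]→L[ℝ] ℝ →L[ℝ] ContinuousMultilinearMap ℝ (fun _ : Fin k => E') ℝ :=
    ContinuousAlternatingMap.toContinuousMultilinearMapCLM ℝ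
  have h2 : ContDiffWithinAt ℝ n (fun y => T (θ y)) s x :=
    T.contDiff.contDiffAt.comp_contDiffWithinAt x hθ
  have h3 := ((alternatizationCLM E k).contDiff.contDiffAt.comp_contDiffWithinAt x
    (h1.clm_apply h2)).const_smul ((k.factorial : ℝ)⁻¹)
  convert h3 using 1
  funext y
  have h4 : ContinuousMultilinearMap.compContinuousLinearMapContinuousMultilinear ℝ
      (fun _ : Fin k => E) (fun _ : Fin k => E') ℝ (fun _ => L y) (T (θ y)) =
      ((θ y).compContinuousLinearMap (L y)).toContinuousMultilinearMap := rfl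
  simp only [Function.comp_apply]
  rw [h4, alternatizationCLM_toContinuousMultilinearMap, smul_smul,
    inv_mul_cancel₀ (by positivity), one_smul]

theorem minSmoothness_two_le_infty : minSmoothness ℝ 2 ≤ (∞ : WithTop ℕ∞) := by
  rw [minSmoothness_of_isRCLikeNormedField]
  exact (WithTop.coe_le_coe.2 le_top : ((2 : ℕ∞) : WithTop ℕ∞) ≤ ((⊤ : ℕ∞) : WithTop ℕ∞))

theorem extDerivWithin_comp_range {θ : E' → E' [⋀^Fin k]→L[ℝ] ℝ} {g : E → E'} {y : E}
    (hθ : DifferentiableWithinAt ℝ θ (range J) (g y))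
    (hg : ContDiffWithinAt ℝ ∞ g (range I) y) (hy : y ∈ range I)
    (hgm : MapsTo g (range I) (range J)) :
    extDerivWithin (fun z => (θ (g z)).compContinuousLinearMap (fderivWithin ℝ g (range I) z))
      (range I) y =
    (extDerivWithin θ (range J) (g y)).compContinuousLinearMap (fderivWithin ℝ g (range I) y) :=
  extDerivWithin_pullback hθ hg minSmoothness_two_le_infty I.uniqueDiffOn
    (I.range_subset_closure_interior hy) hy hgm

theorem eventually_symm_of_eventually {x₁ p : M} (hp : p ∈ (extChartAt I x₁).source)
    {P : M → Prop} (h : ∀ᶠ q in 𝓝 p, P q) :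
    ∀ᶠ y in 𝓝[range I] (extChartAt I x₁ p), P ((extChartAt I x₁).symm y) := by
  rw [← map_extChartAt_symm_nhdsWithin_range' (I := I) hp] at h
  exact h

theorem contDiffWithinAt_writtenInChart [IsManifold I ∞ M] [IsManifold J ∞ N] {f : M → N}
    {x₁ p : M} {z₁ : N} (hp : p ∈ (extChartAt I x₁).source) (hf : ContMDiffAt I J ∞ f p)
    (hz : f p ∈ (extChartAt J z₁).source) :
    ContDiffWithinAt ℝ ∞ (fun y => extChartAt J z₁ (f ((extChartAt I x₁).symm y))) (range I)
      (extChartAt I x₁ p) := by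
  rw [extChartAt_source] at hp hz
  exact ((contMDiffAt_iff_of_mem_source hp hz).1 hf).2

theorem ContMDiffAt.eventually_mdifferentiableAt [IsManifold I ∞ M] [IsManifold J ∞ N] {f : M → N}
    {p : M} (hf : ContMDiffAt I J ∞ f p) : ∀ᶠ q in 𝓝 p, MDifferentiableAt I J f q := by
  have : IsManifold I 1 M := .of_le (n := ∞) (by simp)
  have : IsManifold J 1 N := .of_le (n := ∞) (by simp)
  have h1 : ContMDiffAt I J 1 f p := hf.of_le (by simp)
  rw [contMDiffAt_iff_contMDiffAt_nhds (by simp)] at h1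
  exact h1.mono fun q hq => hq.mdifferentiableAt one_ne_zero

theorem DForm.inChart_pullback_eventuallyEq [IsManifold I ∞ M] [IsManifold J ∞ N] (σ : DForm J N k)
    {f : M → N} {x₁ p : M} {z₁ : N} (hp : p ∈ (extChartAt I x₁).source)
    (hf : ContMDiffAt I J ∞ f p) (hz : f p ∈ (extChartAt J z₁).source) :
    (DForm.pullback (I := I) f σ).inChart x₁ =ᶠ[𝓝[range I] (extChartAt I x₁ p)] fun y =>
      (σ.inChart z₁ (extChartAt J z₁ (f ((extChartAt I x₁).symm y)))).compContinuousLinearMap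
        (fderivWithin ℝ (fun y => extChartAt J z₁ (f ((extChartAt I x₁).symm y))) (range I) y) := by
  have h1 := eventually_symm_of_eventually (I := I) hp (ContMDiffAt.eventually_mdifferentiableAt hf)
  have h2 := eventually_symm_of_eventually (I := I) hp
    (hf.continuousAt.eventually (extChartAt_source_mem_nhds' hz))
  filter_upwards [h1, h2, extChartAt_target_mem_nhdsWithin' hp] with y hy1 hy2 hy3
  exact DForm.inChart_pullback σ hy3 hy1 hy2

theorem mapsTo_extChartAt_range (z₁ : N) (g : E → N) :
    MapsTo (fun y => extChartAt J z₁ (g y)) (range I) (range J) :=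
  fun _ _ => by rw [extChartAt_coe]; exact mem_range_self _

theorem extChartAt_mem_range (x₁ p : M) : extChartAt I x₁ p ∈ range I := by
  rw [extChartAt_coe]; exact mem_range_self _

theorem DForm.contDiffWithinAt_inChart_pullback [IsManifold I ∞ M] [IsManifold J ∞ N]
    {σ : DForm J N k} {f : M → N} {x₁ p : M} {z₁ : N} (hp : p ∈ (extChartAt I x₁).source)
    (hf : ContMDiffAt I J ∞ f p) (hz : f p ∈ (extChartAt J z₁).source)
    (hσ : ContDiffWithinAt ℝ ∞ (σ.inChart z₁) (range J) (extChartAt J z₁ (f p))) :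
    ContDiffWithinAt ℝ ∞ ((DForm.pullback (I := I) f σ).inChart x₁) (range I)
      (extChartAt I x₁ p) := by
  refine ContDiffWithinAt.congr_of_eventuallyEq_of_mem ?_
    (DForm.inChart_pullback_eventuallyEq σ hp hf hz) (extChartAt_mem_range _ _)
  have hφ := contDiffWithinAt_writtenInChart hp hf hz
  refine contDiffWithinAt_compContinuousLinearMap ?_
    (hφ.fderivWithin_right I.uniqueDiffOn (by simp) (extChartAt_mem_range _ _))
  refine ContDiffWithinAt.comp (t := range J) (g := σ.inChart z₁) _ ?_ hφ
    (mapsTo_extChartAt_range _ _)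
  rwa [(extChartAt I x₁).left_inv hp]

theorem DForm.pullback_id [IsManifold I ∞ M] (σ : DForm I M k) :
    DForm.pullback (I := I) id σ = σ := by
  funext x
  ext v
  rw [DForm.pullback_apply, mfderiv_id]
  rfl

theorem DForm.contDiffWithinAt_inChart_iff [IsManifold I ∞ M] {σ : DForm I M k} {x₁ x₂ p : M}
    (h₁ : p ∈ (extChartAt I x₁).source) (h₂ : p ∈ (extChartAt I x₂).source) :
    ContDiffWithinAt ℝ ∞ (σ.inChart x₁) (range I) (extChartAt I x₁ p) ↔
      ContDiffWithinAt ℝ ∞ (σ.inChart x₂) (range I) (extChartAt I x₂ p) := by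
  constructor <;> intro h
  · rw [← DForm.pullback_id σ]
    exact DForm.contDiffWithinAt_inChart_pullback h₂ contMDiffAt_id h₁ h
  · rw [← DForm.pullback_id σ]
    exact DForm.contDiffWithinAt_inChart_pullback h₁ contMDiffAt_id h₂ h

theorem DForm.SmoothAt.inChart [IsManifold I ∞ M] {σ : DForm I M k} {x₁ p : M}
    (hσ : σ.SmoothAt p) (h₁ : p ∈ (extChartAt I x₁).source) :
    ContDiffWithinAt ℝ ∞ (σ.inChart x₁) (range I) (extChartAt I x₁ p) :=
  (DForm.contDiffWithinAt_inChart_iff (mem_extChartAt_source p) h₁).1 hσ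

theorem DForm.SmoothAt.pullback [IsManifold I ∞ M] [IsManifold J ∞ N] {σ : DForm J N k}
    {f : M → N} {p : M} (hσ : σ.SmoothAt (f p)) (hf : ContMDiffAt I J ∞ f p) :
    (DForm.pullback (I := I) f σ).SmoothAt p :=
  DForm.contDiffWithinAt_inChart_pullback (mem_extChartAt_source p) hf
    (mem_extChartAt_source (f p)) hσ

theorem DForm.smoothOn_iff [IsManifold I ∞ M] {σ : DForm I M k} {U : Set M} (hU : IsOpen U) :
    σ.SmoothOn U ↔ ∀ p ∈ U, σ.SmoothAt p := by
  constructor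
  · intro h p hp
    have h1 := h p (extChartAt I p p) ⟨mem_extChartAt_target p, by
      rw [mem_preimage, extChartAt_to_inv]; exact hp⟩
    refine h1.mono_of_mem_nhdsWithin ?_
    exact Filter.inter_mem (extChartAt_target_mem_nhdsWithin p)
      (eventually_symm_of_eventually (mem_extChartAt_source p) (hU.mem_nhds hp))
  · intro h x₀ y hy
    have h1 := (h _ hy.2).inChart (x₁ := x₀) ((extChartAt I x₀).map_target hy.1)
    rw [(extChartAt I x₀).right_inv hy.1] at h1
    exact h1.mono (inter_subset_left.trans (extChartAt_target_subset_range x₀))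

theorem DForm.smooth_iff [IsManifold I ∞ M] {σ : DForm I M k} :
    σ.Smooth ↔ ∀ p, σ.SmoothAt p := by
  simp [DForm.Smooth, DForm.smoothOn_iff isOpen_univ]

theorem DForm.inChart_congr {σ τ : DForm I M k} {x₁ p : M} (hp : p ∈ (extChartAt I x₁).source)
    (h : ∀ᶠ q in 𝓝 p, σ q = τ q) :
    σ.inChart x₁ =ᶠ[𝓝[range I] (extChartAt I x₁ p)] τ.inChart x₁ := by
  filter_upwards [eventually_symm_of_eventually hp h] with y hy
  simp only [DForm.inChart, hy]

theorem DForm.SmoothAt.congr {σ τ : DForm I M k} {p : M} (hσ : σ.SmoothAt p)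
    (h : ∀ᶠ q in 𝓝 p, σ q = τ q) : τ.SmoothAt p :=
  ContDiffWithinAt.congr_of_eventuallyEq_of_mem hσ
    (DForm.inChart_congr (mem_extChartAt_source p) h).symm (extChartAt_mem_range _ _)

theorem DForm.d_congr {σ τ : DForm I M k} {p : M} (h : ∀ᶠ q in 𝓝 p, σ q = τ q) :
    σ.d p = τ.d p := by
  have := (DForm.inChart_congr (mem_extChartAt_source (I := I) p) h).extDerivWithin_eq_of_mem
    (extChartAt_mem_range _ _)
  simp only [DForm.d, this]

theorem DForm.d_apply [IsManifold I ∞ M] (σ : DForm I M k) (x : M)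
    (v : Fin (k + 1) → TangentSpace I x) :
    σ.d x v = extDerivWithin (σ.inChart x) (range I) (extChartAt I x x) v := by
  have : IsManifold I 1 M := .of_le (n := ∞) (by simp)
  rw [DForm.d, mfderiv_extChartAt_self]
  rfl

theorem DForm.d_pullback [IsManifold I ∞ M] [IsManifold J ∞ N] {σ : DForm J N k}
    {f : M → N} {p : M} (hσ : σ.SmoothAt (f p)) (hf : ContMDiffAt I J ∞ f p) :
    (DForm.pullback (I := I) f σ).d p = DForm.pullback f σ.d p := by
  ext v
  rw [DForm.pullback_apply, DForm.d_apply, DForm.d_apply]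
  have h1 := (DForm.inChart_pullback_eventuallyEq σ (mem_extChartAt_source p) hf
    (mem_extChartAt_source (I := J) (f p))).extDerivWithin_eq_of_mem (extChartAt_mem_range _ _)
  have hφ := contDiffWithinAt_writtenInChart (mem_extChartAt_source p) hf
    (mem_extChartAt_source (I := J) (f p))
  rw [h1]
  have hσ' : DifferentiableWithinAt ℝ (σ.inChart (f p)) (range J)
      (extChartAt J (f p) (f ((extChartAt I p).symm (extChartAt I p p)))) := by
    rw [extChartAt_to_inv]
    exact ContDiffWithinAt.differentiableWithinAt hσ (by simp)
  have h2 := extDerivWithin_comp_range (I := I) (J := J) (θ := σ.inChart (f p))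
    (g := fun y => extChartAt J (f p) (f ((extChartAt I p).symm y))) (y := extChartAt I p p)
    hσ' hφ (extChartAt_mem_range _ _)
    (mapsTo_extChartAt_range _ _)
  rw [h2, (hf.mdifferentiableAt (by simp)).mfderiv]
  have e3 : extChartAt J (f p) (f ((extChartAt I p).symm (extChartAt I p p))) =
      extChartAt J (f p) (f p) := by rw [extChartAt_to_inv]
  rw [e3]
  rfl

theorem DForm.inChart_d [IsManifold I ∞ M] {σ : DForm I M k} {x₁ p : M}
    (hp : p ∈ (extChartAt I x₁).source) (hσ : σ.SmoothAt p) :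
    σ.d.inChart x₁ (extChartAt I x₁ p) =
      extDerivWithin (σ.inChart x₁) (range I) (extChartAt I x₁ p) := by
  have : IsManifold I 1 M := .of_le (n := ∞) (by simp)
  have hpp : (extChartAt I x₁).symm (extChartAt I x₁ p) = p := (extChartAt I x₁).left_inv hp
  have hp' : id p ∈ (extChartAt I p).source := mem_extChartAt_source p
  ext v
  have e1 : σ.d.inChart x₁ (extChartAt I x₁ p) v =
      extDerivWithin (σ.inChart p) (range I) (extChartAt I p p) (fun i =>
        (mfderivWithin 𝓘(ℝ, E) I (extChartAt I x₁).symm (range I) (extChartAt I x₁ p) (v i) : E))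
      := by
    rw [DForm.inChart_apply]
    refine (DForm.apply_congr_point σ.d hpp _ _ rfl).trans ?_
    exact DForm.d_apply σ p _
  have h1 := (DForm.inChart_pullback_eventuallyEq σ hp contMDiffAt_id
    hp').extDerivWithin_eq_of_mem (extChartAt_mem_range _ _)
  rw [DForm.pullback_id] at h1
  have hφ := contDiffWithinAt_writtenInChart (I := I) (J := I) hp contMDiffAt_id hp'
  have hσ' : DifferentiableWithinAt ℝ (σ.inChart p) (range I)
      (extChartAt I p (id ((extChartAt I x₁).symm (extChartAt I x₁ p)))) := by
    rw [hpp]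
    exact ContDiffWithinAt.differentiableWithinAt hσ (by simp)
  have h2 := extDerivWithin_comp_range (I := I) (J := I) (θ := σ.inChart p)
    (g := fun y => extChartAt I p (id ((extChartAt I x₁).symm y))) (y := extChartAt I x₁ p)
    hσ' hφ (extChartAt_mem_range _ _)
    (mapsTo_extChartAt_range _ _)
  rw [e1, h1, h2, ContinuousAlternatingMap.compContinuousLinearMap_apply]
  have e2 : ∀ w : E, (mfderivWithin 𝓘(ℝ, E) I (extChartAt I x₁).symm (range I)
      (extChartAt I x₁ p) w : E) = fderivWithin ℝ
        (fun y => extChartAt I p (id ((extChartAt I x₁).symm y))) (range I)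
        (extChartAt I x₁ p) w := by
    intro w
    have h3 := mfderivWithin_comp_chart (I := I) (J := I) (f := id) (z₁ := p)
      ((extChartAt I x₁).map_source hp) mdifferentiableAt_id (by rw [hpp]; exact hp') w
    rw [mfderiv_id] at h3
    refine Eq.trans h3 ?_
    have h4 : (mfderivWithin 𝓘(ℝ, E) I (extChartAt I p).symm (range I)
        (extChartAt I p (id ((extChartAt I x₁).symm (extChartAt I x₁ p)))) : E →L[ℝ] E) =
        ContinuousLinearMap.id ℝ E := by
      have h5 := mfderivWithin_range_extChartAt_symm (I := I) (x := p)
      have h6 : extChartAt I p (id ((extChartAt I x₁).symm (extChartAt I x₁ p))) =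
        extChartAt I p p := by rw [hpp]; rfl
      rw [h6]
      exact h5
    exact congrArg (fun L : E →L[ℝ] E => L _) h4
  have e3 : extChartAt I p (id ((extChartAt I x₁).symm (extChartAt I x₁ p))) =
      extChartAt I p p := by rw [hpp]; rfl
  rw [e3]
  exact congrArg _ (funext fun i => e2 (v i))

theorem DForm.inChart_d_eventuallyEq [IsManifold I ∞ M] {σ : DForm I M k} {x₁ p : M}
    (hp : p ∈ (extChartAt I x₁).source) (hσ : ∀ᶠ q in 𝓝 p, σ.SmoothAt q) :
    σ.d.inChart x₁ =ᶠ[𝓝[range I] (extChartAt I x₁ p)]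
      extDerivWithin (σ.inChart x₁) (range I) := by
  filter_upwards [eventually_symm_of_eventually hp hσ, extChartAt_target_mem_nhdsWithin' hp]
    with y hy hy'
  have := DForm.inChart_d ((extChartAt I x₁).map_target hy') hy
  rwa [(extChartAt I x₁).right_inv hy'] at this

theorem contDiffWithinAt_extDerivWithin {θ : E → E [⋀^Fin k]→L[ℝ] ℝ} {s : Set E} {x : E}
    (h : ContDiffWithinAt ℝ ∞ θ s x) (hs : UniqueDiffOn ℝ s) (hx : x ∈ s) :
    ContDiffWithinAt ℝ ∞ (extDerivWithin θ s) s x :=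
  (ContinuousAlternatingMap.alternatizeUncurryFinCLM ℝ E ℝ).contDiff.contDiffAt
    |>.comp_contDiffWithinAt x (h.fderivWithin_right hs (by simp) hx)

theorem DForm.SmoothAt.d [IsManifold I ∞ M] {σ : DForm I M k} {p : M}
    (hσ : ∀ᶠ q in 𝓝 p, σ.SmoothAt q) : σ.d.SmoothAt p :=
  ContDiffWithinAt.congr_of_eventuallyEq_of_mem
    (contDiffWithinAt_extDerivWithin hσ.self_of_nhds I.uniqueDiffOn (extChartAt_mem_range _ _))
    (DForm.inChart_d_eventuallyEq (mem_extChartAt_source p) hσ) (extChartAt_mem_range _ _)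

theorem DForm.d_d [IsManifold I ∞ M] {σ : DForm I M k} {p : M}
    (hσ : ∀ᶠ q in 𝓝 p, σ.SmoothAt q) : σ.d.d p = 0 := by
  ext v
  have h := (DForm.inChart_d_eventuallyEq (mem_extChartAt_source p) hσ).extDerivWithin_eq_of_mem
    (extChartAt_mem_range _ _)
  rw [DForm.d_apply, h, extDerivWithin_extDerivWithin_apply hσ.self_of_nhds
    minSmoothness_two_le_infty
    I.uniqueDiffOn (I.range_subset_closure_interior (extChartAt_mem_range _ _))
    (extChartAt_mem_range _ _)]
  rfl

theorem DForm.SmoothAt.add {σ τ : DForm I M k} {p : M} (hσ : σ.SmoothAt p) (hτ : τ.SmoothAt p) :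
    DForm.SmoothAt (I := I) (k := k) (fun x => σ x + τ x) p :=
  ContDiffWithinAt.add hσ hτ

theorem contDiffWithinAt_comp_symm {f : M → ℝ} {p : M} (hf : ContMDiffAt I 𝓘(ℝ, ℝ) ∞ f p) :
    ContDiffWithinAt ℝ ∞ (fun y => f ((extChartAt I p).symm y)) (range I) (extChartAt I p p) :=
  (contMDiffAt_iff.1 hf).2

theorem DForm.SmoothAt.smul {f : M → ℝ} {σ : DForm I M k} {p : M}
    (hf : ContMDiffAt I 𝓘(ℝ, ℝ) ∞ f p) (hσ : σ.SmoothAt p) :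
    DForm.SmoothAt (I := I) (k := k) (fun x => f x • σ x) p :=
  ContDiffWithinAt.smul (contDiffWithinAt_comp_symm hf) hσ

theorem DForm.smoothAt_zero (p : M) : DForm.SmoothAt (I := I) (k := k) (fun _ => 0) p := by
  have h : DForm.inChart (I := I) (k := k) (fun _ => 0) p = fun _ => 0 := by
    funext y; ext v; rfl
  rw [DForm.SmoothAt, h]
  exact contDiffWithinAt_const

theorem DForm.SmoothAt.sum {α : Type*} {s : Finset α} {σ : α → DForm I M k} {p : M}
    (h : ∀ i ∈ s, (σ i).SmoothAt p) :
    DForm.SmoothAt (I := I) (k := k) (fun x => ∑ i ∈ s, σ i x) p := by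
  classical
  induction s using Finset.induction_on with
  | empty => simpa using DForm.smoothAt_zero p
  | insert a s ha ih =>
    simp only [Finset.sum_insert ha]
    exact (h a (by simp)).add (ih fun i hi => h i (by simp [hi]))

theorem DForm.SmoothAt.differentiableWithinAt {σ : DForm I M k} {p : M} (hσ : σ.SmoothAt p) :
    DifferentiableWithinAt ℝ (σ.inChart p) (range I) (extChartAt I p p) :=
  ContDiffWithinAt.differentiableWithinAt hσ (by simp)

theorem DForm.d_add [IsManifold I ∞ M] {σ τ : DForm I M k} {p : M} (hσ : σ.SmoothAt p)
    (hτ : τ.SmoothAt p) : DForm.d (I := I) (k := k) (fun x => σ x + τ x) p = σ.d p + τ.d p := by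
  ext v
  have h := extDerivWithin_add (I.uniqueDiffOn _ (extChartAt_mem_range p p))
    hσ.differentiableWithinAt hτ.differentiableWithinAt
  rw [ContinuousAlternatingMap.add_apply, DForm.d_apply, DForm.d_apply, DForm.d_apply]
  exact congrArg (fun L : E [⋀^Fin (k + 1)]→L[ℝ] ℝ => L v) h

/-- A function as a form of degree `0`. -/
def DForm.ofFun (f : M → ℝ) : DForm I M 0 := fun x =>
  ContinuousAlternatingMap.constOfIsEmpty ℝ (TangentSpace I x) (Fin 0) (f x)

theorem DForm.inChart_ofFun (f : M → ℝ) (p : M) :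
    (DForm.ofFun (I := I) f).inChart p = fun y =>
      ContinuousAlternatingMap.constOfIsEmpty ℝ E (Fin 0) (f ((extChartAt I p).symm y)) := by
  funext y; ext v; rfl

theorem DForm.smoothAt_ofFun {f : M → ℝ} {p : M} (hf : ContMDiffAt I 𝓘(ℝ, ℝ) ∞ f p) :
    (DForm.ofFun (I := I) f).SmoothAt p := by
  rw [DForm.SmoothAt, DForm.inChart_ofFun]
  exact (ContinuousAlternatingMap.constOfIsEmptyLIE ℝ E ℝ (Fin 0)).contDiff.contDiffAt
    |>.comp_contDiffWithinAt _ (contDiffWithinAt_comp_symm hf)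

theorem mfderiv_apply_eq_fderivWithin {f : M → ℝ} {p : M} (hf : MDifferentiableAt I 𝓘(ℝ, ℝ) f p)
    (v : TangentSpace I p) : (mfderiv I 𝓘(ℝ, ℝ) f p v : ℝ) =
      fderivWithin ℝ (fun y => f ((extChartAt I p).symm y)) (range I) (extChartAt I p p) v := by
  rw [hf.mfderiv]; rfl

theorem DForm.d_ofFun_apply [IsManifold I ∞ M] {f : M → ℝ} {p : M}
    (hf : MDifferentiableAt I 𝓘(ℝ, ℝ) f p) (v : TangentSpace I p) :
    (DForm.ofFun (I := I) f).d p ![v] = (mfderiv I 𝓘(ℝ, ℝ) f p v : ℝ) := by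
  rw [DForm.d_apply, DForm.inChart_ofFun, extDerivWithin_constOfIsEmpty _
    (I.uniqueDiffOn _ (extChartAt_mem_range p p)), mfderiv_apply_eq_fderivWithin hf]
  rfl

theorem extDerivWithin_one_apply {θ : E → E [⋀^Fin 1]→L[ℝ] ℝ} {s : Set E} {y : E}
    (h : DifferentiableWithinAt ℝ θ s y) (hs : UniqueDiffWithinAt ℝ s y) (v w : E) :
    extDerivWithin θ s y ![v, w] = fderivWithin ℝ (fun z => θ z ![w]) s y v
      - fderivWithin ℝ (fun z => θ z ![v]) s y w := by
  have e0 : (0 : Fin 2).removeNth ![v, w] = ![w] := by ext i; fin_cases i; rfl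
  have e1 : (1 : Fin 2).removeNth ![v, w] = ![v] := by ext i; fin_cases i; rfl
  rw [extDerivWithin_apply h hs, Fin.sum_univ_two, e0, e1]
  simp [sub_eq_add_neg]

theorem DForm.d_smul_apply [IsManifold I ∞ M] {f : M → ℝ} {μ : DForm I M 1} {p : M}
    (hf : ContMDiffAt I 𝓘(ℝ, ℝ) ∞ f p) (hμ : μ.SmoothAt p) (v w : TangentSpace I p) :
    DForm.d (I := I) (k := 1) (fun x => f x • μ x) p ![v, w] = f p * μ.d p ![v, w]
      + (DForm.ofFun f).d p ![v] * μ p ![w] - (DForm.ofFun f).d p ![w] * μ p ![v] := by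
  have : IsManifold I 1 M := .of_le (n := ∞) (by simp)
  have hs := I.uniqueDiffOn _ (extChartAt_mem_range (I := I) p p)
  have hfd := (contDiffWithinAt_comp_symm hf).differentiableWithinAt (by simp)
  have hμd := hμ.differentiableWithinAt
  have e0 : ∀ b : E, μ.inChart p (extChartAt I p p) ![b] = μ p ![b] := by
    intro b
    have h1 := mfderivWithin_range_extChartAt_symm (I := I) (x := p)
    rw [DForm.inChart_apply, h1]
    exact DForm.apply_congr_point μ (extChartAt_to_inv p) _ _ (by funext i; fin_cases i; rfl)
  have key : ∀ a b : E, fderivWithin ℝ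
      (fun z => (DForm.inChart (I := I) (k := 1) (fun x => f x • μ x) p z) ![b]) (range I)
        (extChartAt I p p) a =
      f p * fderivWithin ℝ (fun z => μ.inChart p z ![b]) (range I) (extChartAt I p p) a
      + fderivWithin ℝ (fun y => f ((extChartAt I p).symm y)) (range I) (extChartAt I p p) a
        * μ p ![b] := by
    intro a b
    rw [← e0 b]
    have hb : DifferentiableWithinAt ℝ (fun z => μ.inChart p z ![b]) (range I)
        (extChartAt I p p) :=
      (ContinuousAlternatingMap.apply ℝ E ℝ ![b]).differentiableAt.comp_differentiableWithinAt
        _ hμd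
    have e : (fun z => (DForm.inChart (I := I) (k := 1) (fun x => f x • μ x) p z) ![b]) =
        fun z => f ((extChartAt I p).symm z) * μ.inChart p z ![b] := by
      funext z; rfl
    rw [e, fderivWithin_fun_mul hs hfd hb]
    simp [mul_comm]
  rw [DForm.d_apply, DForm.d_apply,
    DForm.d_ofFun_apply (hf.mdifferentiableAt (by simp)),
    DForm.d_ofFun_apply (hf.mdifferentiableAt (by simp)),
    mfderiv_apply_eq_fderivWithin (hf.mdifferentiableAt (by simp)),
    mfderiv_apply_eq_fderivWithin (hf.mdifferentiableAt (by simp))]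
  have h1 := extDerivWithin_one_apply hμd hs v w
  have h2 := extDerivWithin_one_apply (DForm.SmoothAt.smul hf hμ).differentiableWithinAt hs v w
  refine h2.trans ((congrArg₂ (fun a b : ℝ => a - b) (key v w) (key w v)).trans ?_)
  refine Eq.trans ?_ (congrArg (fun t => f p * t + _ * μ p ![w] - _ * μ p ![v]) h1.symm)
  ring

theorem DForm.d_ofFun_comp_apply [IsManifold I ∞ M] {φ : ℝ → ℝ} {f : M → ℝ} {p : M}
    (hφ : DifferentiableAt ℝ φ (f p)) (hf : MDifferentiableAt I 𝓘(ℝ, ℝ) f p)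
    (v : TangentSpace I p) : (DForm.ofFun (I := I) (fun x => φ (f x))).d p ![v] =
      deriv φ (f p) * (DForm.ofFun (I := I) f).d p ![v] := by
  have h1 : MDifferentiableAt I 𝓘(ℝ, ℝ) (fun x => φ (f x)) p := hφ.mdifferentiableAt.comp p hf
  rw [DForm.d_ofFun_apply h1, DForm.d_ofFun_apply hf, mfderiv_apply_eq_fderivWithin h1,
    mfderiv_apply_eq_fderivWithin hf]
  have h2 : DifferentiableWithinAt ℝ (fun y => f ((extChartAt I p).symm y)) (range I)
      (extChartAt I p p) := ((mdifferentiableAt_iff _ _).1 hf).2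
  have h3 : HasDerivAt φ (deriv φ (f p)) (f ((extChartAt I p).symm (extChartAt I p p))) := by
    rw [extChartAt_to_inv]; exact hφ.hasDerivAt
  have h4 := (HasDerivAt.comp_hasFDerivWithinAt (f := fun y => f ((extChartAt I p).symm y)) _ h3
    h2.hasFDerivWithinAt).fderivWithin
    (I.uniqueDiffOn _ (extChartAt_mem_range (I := I) p p))
  exact congrArg (fun L : E →L[ℝ] ℝ => L v) h4

theorem DForm.SmoothAt.continuousAt_apply [IsManifold I ∞ M] {σ : DForm I M k} {p : M}
    (hσ : σ.SmoothAt p) (e : Fin k → E) :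
    ContinuousAt (fun q => σ q (fun i =>
      (mfderivWithin 𝓘(ℝ, E) I (extChartAt I p).symm (range I) (extChartAt I p q) (e i) : E)))
      p := by
  have h1 : ContinuousWithinAt (fun y => σ.inChart p y e) (range I) (extChartAt I p p) :=
    (ContinuousAlternatingMap.apply ℝ E ℝ e).continuous.continuousAt.comp_continuousWithinAt
      (ContDiffWithinAt.continuousWithinAt hσ)
  have h2 : ContinuousAt (fun q => σ.inChart p (extChartAt I p q) e) p := by
    have := h1.comp_of_eq (f := extChartAt I p) (s := univ)
      (continuousAt_extChartAt p).continuousWithinAt (fun _ _ => extChartAt_mem_range _ _) rfl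
    exact this.continuousAt Filter.univ_mem
  refine h2.congr ?_
  filter_upwards [extChartAt_source_mem_nhds (I := I) p] with q hq
  exact DForm.apply_congr_point σ ((extChartAt I p).left_inv hq) _ _ rfl

theorem update_single {Y : Type*} (a x : Y) : Function.update ![a] 0 x = ![x] := by
  ext i; fin_cases i; rfl

theorem update_pair_zero {Y : Type*} (a b x : Y) : Function.update ![a, b] 0 x = ![x, b] := by
  ext i; fin_cases i <;> rfl

theorem update_pair_one {Y : Type*} (a b x : Y) : Function.update ![a, b] 1 x = ![a, x] := by
  ext i; fin_cases i <;> rfl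

section Algebra

variable {X : Type*} [NormedAddCommGroup X] [NormedSpace ℝ X]

theorem ContinuousAlternatingMap.single_add (A : X [⋀^Fin 1]→L[ℝ] ℝ) (a b : X) :
    A ![a + b] = A ![a] + A ![b] := by
  simpa only [update_single] using A.map_update_add ![a] 0 a b

theorem ContinuousAlternatingMap.single_smul (A : X [⋀^Fin 1]→L[ℝ] ℝ) (t : ℝ) (a : X) :
    A ![t • a] = t * A ![a] := by
  simpa only [update_single, smul_eq_mul] using A.map_update_smul ![a] 0 t a

theorem ContinuousAlternatingMap.pair_add_left (B : X [⋀^Fin 2]→L[ℝ] ℝ) (a a' b : X) :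
    B ![a + a', b] = B ![a, b] + B ![a', b] := by
  simpa only [update_pair_zero, update_pair_one] using B.map_update_add ![a, b] 0 a a'

theorem ContinuousAlternatingMap.pair_add_right (B : X [⋀^Fin 2]→L[ℝ] ℝ) (a b b' : X) :
    B ![a, b + b'] = B ![a, b] + B ![a, b'] := by
  simpa only [update_pair_zero, update_pair_one] using B.map_update_add ![a, b] 1 b b'

theorem ContinuousAlternatingMap.pair_smul_left (B : X [⋀^Fin 2]→L[ℝ] ℝ) (t : ℝ) (a b : X) :
    B ![t • a, b] = t * B ![a, b] := by
  simpa only [update_pair_zero, update_pair_one, smul_eq_mul] using B.map_update_smul ![a, b] 0 t a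

theorem ContinuousAlternatingMap.pair_smul_right (B : X [⋀^Fin 2]→L[ℝ] ℝ) (t : ℝ) (a b : X) :
    B ![a, t • b] = t * B ![a, b] := by
  simpa only [update_pair_zero, update_pair_one, smul_eq_mul] using B.map_update_smul ![a, b] 1 t b

theorem ContinuousAlternatingMap.pair_self (B : X [⋀^Fin 2]→L[ℝ] ℝ) (a : X) :
    B ![a, a] = 0 :=
  B.map_eq_zero_of_eq ![a, a] (i := 0) (j := 1) rfl (by decide)

theorem ContinuousAlternatingMap.pair_swap (B : X [⋀^Fin 2]→L[ℝ] ℝ) (a b : X) :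
    B ![a, b] = -B ![b, a] := by
  have h := ContinuousAlternatingMap.pair_self B (a + b)
  rw [ContinuousAlternatingMap.pair_add_left, ContinuousAlternatingMap.pair_add_right,
    ContinuousAlternatingMap.pair_add_right, ContinuousAlternatingMap.pair_self,
    ContinuousAlternatingMap.pair_self] at h
  linarith

/-- The Pfaffian `B₀₁ B₂₃ - B₀₂ B₁₃ + B₀₃ B₁₂` of a 2-form, as an alternating form in the four
vectors; it is half the wedge square of the form. -/
def pfaffian (B : X [⋀^Fin 2]→L[ℝ] ℝ) : X [⋀^Fin 4]→ₗ[ℝ] ℝ where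
  toFun v := B ![v 0, v 1] * B ![v 2, v 3] - B ![v 0, v 2] * B ![v 1, v 3]
    + B ![v 0, v 3] * B ![v 1, v 2]
  map_update_add' {inst} v i x y := by
    obtain rfl : inst = instDecidableEqFin 4 := Subsingleton.elim _ _
    fin_cases i <;>
    simp [Function.update, ContinuousAlternatingMap.pair_add_left,
      ContinuousAlternatingMap.pair_add_right] <;> ring
  map_update_smul' {inst} v i t x := by
    obtain rfl : inst = instDecidableEqFin 4 := Subsingleton.elim _ _
    fin_cases i <;>
    simp [Function.update, ContinuousAlternatingMap.pair_smul_left,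
      ContinuousAlternatingMap.pair_smul_right] <;> ring
  map_eq_zero_of_eq' v i j h hij := by
    have h10 := ContinuousAlternatingMap.pair_swap B (v 1) (v 0)
    have h20 := ContinuousAlternatingMap.pair_swap B (v 2) (v 0)
    have h30 := ContinuousAlternatingMap.pair_swap B (v 3) (v 0)
    have h21 := ContinuousAlternatingMap.pair_swap B (v 2) (v 1)
    have h31 := ContinuousAlternatingMap.pair_swap B (v 3) (v 1)
    have h32 := ContinuousAlternatingMap.pair_swap B (v 3) (v 2)
    fin_cases i <;> fin_cases j <;> first | exact absurd rfl hij | skip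
    all_goals
      simp only [Fin.zero_eta, Fin.mk_one, Fin.reduceFinMk] at h
      simp only [h, ContinuousAlternatingMap.pair_self]
      try simp only [h10, h20, h21, h31, h32]
      ring

theorem pfaffian_apply (B : X [⋀^Fin 2]→L[ℝ] ℝ) (v : Fin 4 → X) :
    pfaffian B v = B ![v 0, v 1] * B ![v 2, v 3] - B ![v 0, v 2] * B ![v 1, v 3]
    + B ![v 0, v 3] * B ![v 1, v 2] := rfl

theorem AlternatingMap.linearIndependent_of_ne_zero {ι : Type*} (Ω : X [⋀^ι]→ₗ[ℝ] ℝ) {e : ι → X}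
    (h : Ω e ≠ 0) : LinearIndependent ℝ e := by
  by_contra hd
  exact h (Ω.map_linearDependent e hd)

theorem AlternatingMap.exists_basis_of_ne_zero {n : ℕ} [NeZero n] (hX : Module.finrank ℝ X = n)
    (Ω : X [⋀^Fin n]→ₗ[ℝ] ℝ) {e : Fin n → X} (h : Ω e ≠ 0) :
    ∃ b : Module.Basis (Fin n) ℝ X, ⇑b = e :=
  ⟨basisOfLinearIndependentOfCardEqFinrank (AlternatingMap.linearIndependent_of_ne_zero Ω h)
    (by simp [hX]), coe_basisOfLinearIndependentOfCardEqFinrank _ _⟩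

/-- Two top-degree forms which are positive on one frame are positive on the same frames. -/
theorem AlternatingMap.pos_of_pos (hX : Module.finrank ℝ X = 4) {Ω Ω' : X [⋀^Fin 4]→ₗ[ℝ] ℝ}
    {e u : Fin 4 → X} (h : 0 < Ω e) (h' : 0 < Ω' e) (hu : 0 < Ω u) : 0 < Ω' u := by
  obtain ⟨b, rfl⟩ := AlternatingMap.exists_basis_of_ne_zero hX Ω h.ne'
  rw [Ω.eq_smul_basis_det b, AlternatingMap.smul_apply, smul_eq_mul] at hu
  rw [Ω'.eq_smul_basis_det b, AlternatingMap.smul_apply, smul_eq_mul]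
  exact mul_pos h' (pos_of_mul_pos_right hu h.le)

theorem eq_zero_of_pfaffian_ne_zero (hX : Module.finrank ℝ X = 4) {B : X [⋀^Fin 2]→L[ℝ] ℝ}
    {e : Fin 4 → X} (h : pfaffian B e ≠ 0) {v : X} (hv : ∀ w, B ![v, w] = 0) : v = 0 := by
  obtain ⟨b, rfl⟩ := AlternatingMap.exists_basis_of_ne_zero hX (pfaffian B) h
  have hv' : ∀ w, B ![w, v] = 0 := fun w => by
    rw [ContinuousAlternatingMap.pair_swap, hv, neg_zero]
  refine b.ext_elem fun j => ?_
  have h1 : pfaffian B (Function.update b j v) = 0 := by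
    rw [pfaffian_apply]
    fin_cases j <;> simp [Function.update, hv, hv']
  have h2 : pfaffian B (Function.update b j v) = b.repr v j * pfaffian B b := by
    conv_lhs => rw [← b.sum_repr v]
    rw [AlternatingMap.map_update_sum, Finset.sum_eq_single j]
    · rw [AlternatingMap.map_update_smul, Function.update_eq_self, smul_eq_mul]
    · intro i _ hij
      rw [AlternatingMap.map_update_smul, AlternatingMap.map_update_self _ _ hij.symm, smul_zero]
    · simp
  rw [h1] at h2
  simpa using (mul_eq_zero.1 h2.symm).resolve_right h

/-- The wedge product of a 1-form and a 2-form, as an alternating form. -/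
def wedgeOneTwo (A : X [⋀^Fin 1]→L[ℝ] ℝ) (B : X [⋀^Fin 2]→L[ℝ] ℝ) : X [⋀^Fin 3]→ₗ[ℝ] ℝ where
  toFun v := A ![v 0] * B ![v 1, v 2] - A ![v 1] * B ![v 0, v 2] + A ![v 2] * B ![v 0, v 1]
  map_update_add' {inst} v i x y := by
    obtain rfl : inst = instDecidableEqFin 3 := Subsingleton.elim _ _
    fin_cases i <;>
    simp [Function.update, ContinuousAlternatingMap.pair_add_left,
      ContinuousAlternatingMap.pair_add_right, ContinuousAlternatingMap.single_add] <;> ring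
  map_update_smul' {inst} v i t x := by
    obtain rfl : inst = instDecidableEqFin 3 := Subsingleton.elim _ _
    fin_cases i <;>
    simp [Function.update, ContinuousAlternatingMap.pair_smul_left,
      ContinuousAlternatingMap.pair_smul_right, ContinuousAlternatingMap.single_smul] <;> ring
  map_eq_zero_of_eq' v i j h hij := by
    have h10 := ContinuousAlternatingMap.pair_swap B (v 1) (v 0)
    have h20 := ContinuousAlternatingMap.pair_swap B (v 2) (v 0)
    have h21 := ContinuousAlternatingMap.pair_swap B (v 2) (v 1)
    fin_cases i <;> fin_cases j <;> first | exact absurd rfl hij | skip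
    all_goals
      simp only [Fin.zero_eta, Fin.mk_one, Fin.reduceFinMk] at h
      simp only [h, ContinuousAlternatingMap.pair_self]
      try simp only [h10, h21]
      ring

theorem wedgeOneTwo_apply (A : X [⋀^Fin 1]→L[ℝ] ℝ) (B : X [⋀^Fin 2]→L[ℝ] ℝ) (v : Fin 3 → X) :
    wedgeOneTwo A B v =
      A ![v 0] * B ![v 1, v 2] - A ![v 1] * B ![v 0, v 2] + A ![v 2] * B ![v 0, v 1] := rfl

/-- A contact form has a positive transverse vector, and its differential is positive on some frame
of its kernel. -/
theorem exists_frame_of_wedgeOneTwo_ne_zero {A : X [⋀^Fin 1]→L[ℝ] ℝ} {B : X [⋀^Fin 2]→L[ℝ] ℝ}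
    {v : Fin 3 → X} (h : wedgeOneTwo A B v ≠ 0) :
    ∃ R u w : X, 0 < A ![R] ∧ A ![u] = 0 ∧ A ![w] = 0 ∧ 0 < B ![u, w] := by
  have hA : ∃ R, A ![R] = 1 := by
    by_contra hcon
    push Not at hcon
    have h0 : ∀ a, A ![a] = 0 := fun a => by
      by_contra ha
      exact hcon ((A ![a])⁻¹ • a) (by rw [ContinuousAlternatingMap.single_smul, inv_mul_cancel₀ ha])
    exact h (by simp [wedgeOneTwo_apply, h0])
  obtain ⟨R, hR⟩ := hA
  have hB : ∃ u w : X, A ![u] = 0 ∧ A ![w] = 0 ∧ B ![u, w] ≠ 0 := by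
    by_contra hcon
    push Not at hcon
    have hker : ∀ a, A ![a + (-A ![a]) • R] = 0 := fun a => by
      rw [ContinuousAlternatingMap.single_add, ContinuousAlternatingMap.single_smul, hR]; ring
    have hpair : ∀ a b, B ![a, b] = A ![a] * B ![R, b] - A ![b] * B ![R, a] := fun a b => by
      have h1 := hcon _ _ (hker a) (hker b)
      simp only [ContinuousAlternatingMap.pair_add_left, ContinuousAlternatingMap.pair_add_right,
        ContinuousAlternatingMap.pair_smul_left, ContinuousAlternatingMap.pair_smul_right,
        ContinuousAlternatingMap.pair_self] at h1
      have h2 := ContinuousAlternatingMap.pair_swap B a R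
      rw [h2] at h1
      linarith
    refine h ?_
    rw [wedgeOneTwo_apply, hpair (v 1) (v 2), hpair (v 0) (v 2), hpair (v 0) (v 1)]
    ring
  obtain ⟨u, w, hu, hw, huw⟩ := hB
  rcases huw.lt_or_gt with h1 | h1
  · refine ⟨R, w, u, by rw [hR]; exact one_pos, hw, hu, ?_⟩
    rw [ContinuousAlternatingMap.pair_swap]
    linarith
  · exact ⟨R, u, w, by rw [hR]; exact one_pos, hu, hw, h1⟩

end Algebra

/-- The Pfaffian of the matrix of the form `s + f (C l - s) - k r ∧ (C λ - α)`. -/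
theorem pfaffian_modification_pos {s₀₁ s₀₂ s₀₃ s₁₂ s₁₃ s₂₃ l₀₁ l₀₂ l₀₃ l₁₂ l₁₃ l₂₃
    r₀ r₁ r₂ r₃ m₀ m₁ m₂ m₃ a₀ a₁ a₂ a₃ f k C K c B : ℝ}
    (hf₀ : 0 ≤ f) (hf₁ : f ≤ 1) (hk : K * f ≤ k) (hK : 0 < K) (hc : 0 < c) (hC : 0 < C)
    (hKc : 2 * B ≤ K * c) (hCc : 2 * B + 2 ≤ C * c)
    (hs : 0 < s₀₁ * s₂₃ - s₀₂ * s₁₃ + s₀₃ * s₁₂)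
    (hsr : c ≤ -(s₀₁ * (r₂ * m₃ - r₃ * m₂) - s₀₂ * (r₁ * m₃ - r₃ * m₁)
      + s₀₃ * (r₁ * m₂ - r₂ * m₁) + (r₀ * m₁ - r₁ * m₀) * s₂₃ - (r₀ * m₂ - r₂ * m₀) * s₁₃
      + (r₀ * m₃ - r₃ * m₀) * s₁₂))
    (hlr : c ≤ -(l₀₁ * (r₂ * m₃ - r₃ * m₂) - l₀₂ * (r₁ * m₃ - r₃ * m₁)
      + l₀₃ * (r₁ * m₂ - r₂ * m₁) + (r₀ * m₁ - r₁ * m₀) * l₂₃ - (r₀ * m₂ - r₂ * m₀) * l₁₃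
      + (r₀ * m₃ - r₃ * m₀) * l₁₂))
    (hll : |l₀₁ * l₂₃ - l₀₂ * l₁₃ + l₀₃ * l₁₂| ≤ B)
    (hsl : |s₀₁ * l₂₃ - s₀₂ * l₁₃ + s₀₃ * l₁₂ + l₀₁ * s₂₃ - l₀₂ * s₁₃ + l₀₃ * s₁₂| ≤ B)
    (hsa : |s₀₁ * (r₂ * a₃ - r₃ * a₂) - s₀₂ * (r₁ * a₃ - r₃ * a₁)
      + s₀₃ * (r₁ * a₂ - r₂ * a₁) + (r₀ * a₁ - r₁ * a₀) * s₂₃ - (r₀ * a₂ - r₂ * a₀) * s₁₃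
      + (r₀ * a₃ - r₃ * a₀) * s₁₂| ≤ B)
    (hla : |l₀₁ * (r₂ * a₃ - r₃ * a₂) - l₀₂ * (r₁ * a₃ - r₃ * a₁)
      + l₀₃ * (r₁ * a₂ - r₂ * a₁) + (r₀ * a₁ - r₁ * a₀) * l₂₃ - (r₀ * a₂ - r₂ * a₀) * l₁₃
      + (r₀ * a₃ - r₃ * a₀) * l₁₂| ≤ B) :
    0 < (s₀₁ + f * (C * l₀₁ - s₀₁) - k * (r₀ * (C * m₁ - a₁) - r₁ * (C * m₀ - a₀)))
        * (s₂₃ + f * (C * l₂₃ - s₂₃) - k * (r₂ * (C * m₃ - a₃) - r₃ * (C * m₂ - a₂)))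
      - (s₀₂ + f * (C * l₀₂ - s₀₂) - k * (r₀ * (C * m₂ - a₂) - r₂ * (C * m₀ - a₀)))
        * (s₁₃ + f * (C * l₁₃ - s₁₃) - k * (r₁ * (C * m₃ - a₃) - r₃ * (C * m₁ - a₁)))
      + (s₀₃ + f * (C * l₀₃ - s₀₃) - k * (r₀ * (C * m₃ - a₃) - r₃ * (C * m₀ - a₀)))
        * (s₁₂ + f * (C * l₁₂ - s₁₂) - k * (r₁ * (C * m₂ - a₂) - r₂ * (C * m₁ - a₁))) := by
  set q := s₀₁ * s₂₃ - s₀₂ * s₁₃ + s₀₃ * s₁₂ with hq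
  generalize hA : -(s₀₁ * (r₂ * m₃ - r₃ * m₂) - s₀₂ * (r₁ * m₃ - r₃ * m₁)
      + s₀₃ * (r₁ * m₂ - r₂ * m₁) + (r₀ * m₁ - r₁ * m₀) * s₂₃ - (r₀ * m₂ - r₂ * m₀) * s₁₃
      + (r₀ * m₃ - r₃ * m₀) * s₁₂) = A at hsr
  generalize hD : -(l₀₁ * (r₂ * m₃ - r₃ * m₂) - l₀₂ * (r₁ * m₃ - r₃ * m₁)
      + l₀₃ * (r₁ * m₂ - r₂ * m₁) + (r₀ * m₁ - r₁ * m₀) * l₂₃ - (r₀ * m₂ - r₂ * m₀) * l₁₃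
      + (r₀ * m₃ - r₃ * m₀) * l₁₂) = D at hlr
  generalize hL : l₀₁ * l₂₃ - l₀₂ * l₁₃ + l₀₃ * l₁₂ = L at hll
  generalize hP : s₀₁ * l₂₃ - s₀₂ * l₁₃ + s₀₃ * l₁₂ + l₀₁ * s₂₃ - l₀₂ * s₁₃ + l₀₃ * s₁₂ = P at hsl
  generalize hR : s₀₁ * (r₂ * a₃ - r₃ * a₂) - s₀₂ * (r₁ * a₃ - r₃ * a₁)
      + s₀₃ * (r₁ * a₂ - r₂ * a₁) + (r₀ * a₁ - r₁ * a₀) * s₂₃ - (r₀ * a₂ - r₂ * a₀) * s₁₃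
      + (r₀ * a₃ - r₃ * a₀) * s₁₂ = R at hsa
  generalize hT : l₀₁ * (r₂ * a₃ - r₃ * a₂) - l₀₂ * (r₁ * a₃ - r₃ * a₁)
      + l₀₃ * (r₁ * a₂ - r₂ * a₁) + (r₀ * a₁ - r₁ * a₀) * l₂₃ - (r₀ * a₂ - r₂ * a₀) * l₁₃
      + (r₀ * a₃ - r₃ * a₀) * l₁₂ = T at hla
  have expand : (s₀₁ + f * (C * l₀₁ - s₀₁) - k * (r₀ * (C * m₁ - a₁) - r₁ * (C * m₀ - a₀)))
        * (s₂₃ + f * (C * l₂₃ - s₂₃) - k * (r₂ * (C * m₃ - a₃) - r₃ * (C * m₂ - a₂)))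
      - (s₀₂ + f * (C * l₀₂ - s₀₂) - k * (r₀ * (C * m₂ - a₂) - r₂ * (C * m₀ - a₀)))
        * (s₁₃ + f * (C * l₁₃ - s₁₃) - k * (r₁ * (C * m₃ - a₃) - r₃ * (C * m₁ - a₁)))
      + (s₀₃ + f * (C * l₀₃ - s₀₃) - k * (r₀ * (C * m₃ - a₃) - r₃ * (C * m₀ - a₀)))
        * (s₁₂ + f * (C * l₁₂ - s₁₂) - k * (r₁ * (C * m₂ - a₂) - r₂ * (C * m₁ - a₁))) =
      (1 - f) ^ 2 * q + f * C * (f * C * L + C * k * D + k * T)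
        + (1 - f) * (f * C * P + k * C * A + k * R) := by
    rw [hq, ← hA, ← hD, ← hL, ← hP, ← hR, ← hT]
    ring
  rw [expand]
  rw [abs_le] at hll hsl hsa hla
  have hB : 0 ≤ B := by linarith [hll.1, hll.2]
  have hk₀ : 0 ≤ k := le_trans (by positivity) hk
  have hfB : 2 * (f * B) ≤ k * c := by
    have h1 : f * (2 * B) ≤ f * (K * c) := mul_le_mul_of_nonneg_left hKc hf₀
    have h2 : K * f * c ≤ k * c := mul_le_mul_of_nonneg_right hk hc.le
    linarith
  have hkB : k * (2 * B + 2) ≤ k * (C * c) := mul_le_mul_of_nonneg_left hCc hk₀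
  have hCf : C * (2 * (f * B)) ≤ C * (k * c) := mul_le_mul_of_nonneg_left hfB hC.le
  have h1 : k ≤ f * C * L + C * k * D + k * T := by
    have e1 : f * C * (-B) ≤ f * C * L := mul_le_mul_of_nonneg_left hll.1 (by positivity)
    have e2 : C * k * c ≤ C * k * D := mul_le_mul_of_nonneg_left hlr (by positivity)
    have e3 : k * (-B) ≤ k * T := mul_le_mul_of_nonneg_left hla.1 hk₀
    linarith
  have h2 : 0 ≤ f * C * P + k * C * A + k * R := by
    have e1 : f * C * (-B) ≤ f * C * P := mul_le_mul_of_nonneg_left hsl.1 (by positivity)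
    have e2 : k * C * c ≤ k * C * A := mul_le_mul_of_nonneg_left hsr (by positivity)
    have e3 : k * (-B) ≤ k * R := mul_le_mul_of_nonneg_left hsa.1 hk₀
    linarith
  have h3 : f * C * k ≤ f * C * (f * C * L + C * k * D + k * T) :=
    mul_le_mul_of_nonneg_left h1 (by positivity)
  have h4 : 0 ≤ (1 - f) * (f * C * P + k * C * A + k * R) := mul_nonneg (by linarith) h2
  rcases hf₁.lt_or_eq with h | h
  · have : 0 < (1 - f) ^ 2 * q := mul_pos (pow_pos (by linarith) 2) hs
    have : 0 ≤ f * C * k := by positivity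
    linarith
  · subst h
    have : 0 < 1 * C * k := by
      have : 0 < k := by linarith
      positivity
    have : (0 : ℝ) ≤ (1 - 1) ^ 2 * q := by simp
    linarith

/-- The Pfaffian of an alternating `4 × 4` matrix, in terms of the entries over the diagonal. -/
def pf (S : Fin 4 → Fin 4 → ℝ) : ℝ := S 0 1 * S 2 3 - S 0 2 * S 1 3 + S 0 3 * S 1 2

/-- The polarization of the Pfaffian. -/
def pfPair (S T : Fin 4 → Fin 4 → ℝ) : ℝ :=
  S 0 1 * T 2 3 - S 0 2 * T 1 3 + S 0 3 * T 1 2 + T 0 1 * S 2 3 - T 0 2 * S 1 3 + T 0 3 * S 1 2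

/-- The matrix of the wedge product of two 1-forms. -/
def wedgeMatrix (u v : Fin 4 → ℝ) (i j : Fin 4) : ℝ := u i * v j - u j * v i

/-- The bounds on the components of the forms that control the modified form. -/
structure FrameBound (S L : Fin 4 → Fin 4 → ℝ) (r m a : Fin 4 → ℝ) (c B : ℝ) : Prop where
  pos : 0 < pf S
  le₁ : c ≤ -pfPair S (wedgeMatrix r m)
  le₂ : c ≤ -pfPair L (wedgeMatrix r m)
  bound₁ : |pf L| ≤ B
  bound₂ : |pfPair S L| ≤ B
  bound₃ : |pfPair S (wedgeMatrix r a)| ≤ B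
  bound₄ : |pfPair L (wedgeMatrix r a)| ≤ B

theorem FrameBound.mono {S L : Fin 4 → Fin 4 → ℝ} {r m a : Fin 4 → ℝ} {c c' B B' : ℝ}
    (h : FrameBound S L r m a c B) (hc : c' ≤ c) (hB : B ≤ B') : FrameBound S L r m a c' B' :=
  ⟨h.pos, hc.trans h.le₁, hc.trans h.le₂, h.bound₁.trans hB, h.bound₂.trans hB,
    h.bound₃.trans hB, h.bound₄.trans hB⟩

theorem FrameBound.pf_pos {S L : Fin 4 → Fin 4 → ℝ} {r m a : Fin 4 → ℝ} {f k C K c B : ℝ}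
    (h : FrameBound S L r m a c B) (hf₀ : 0 ≤ f) (hf₁ : f ≤ 1) (hk : K * f ≤ k) (hK : 0 < K)
    (hc : 0 < c) (hC : 0 < C) (hKc : 2 * B ≤ K * c) (hCc : 2 * B + 2 ≤ C * c) :
    0 < pf fun i j => S i j + f * (C * L i j - S i j)
      - k * (r i * (C * m j - a j) - r j * (C * m i - a i)) :=
  pfaffian_modification_pos hf₀ hf₁ hk hK hc hC hKc hCc h.pos h.le₁ h.le₂ h.bound₁ h.bound₂
    h.bound₃ h.bound₄

/-- A cut-off function which decreases fast relative to its size. -/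
theorem exists_steep_cutoff {δ K : ℝ} (hδ : 0 < δ) (hK : K * δ ^ 2 ≤ 1) :
    ∃ φ : ℝ → ℝ, ContDiff ℝ ∞ φ ∧ φ 0 = 1 ∧ (∀ t, 0 ≤ φ t) ∧ (∀ t, 0 ≤ t → φ t ≤ 1) ∧
      (∀ t, δ ≤ t → φ t = 0) ∧ ∀ t, 0 ≤ t → K * φ t ≤ -deriv φ t := by
  have hd : ∀ x, HasDerivAt expNegInvGlue ((x⁻¹) ^ 2 * expNegInvGlue x) x := by
    intro x
    simpa using expNegInvGlue.hasDerivAt_polynomial_eval_inv_mul (1 : Polynomial ℝ) x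
  have hpos : 0 < expNegInvGlue δ := expNegInvGlue.pos_of_pos hδ
  have hmono : Monotone expNegInvGlue := monotone_of_deriv_nonneg (fun x => (hd x).differentiableAt)
    fun x => by rw [(hd x).deriv]; have := expNegInvGlue.nonneg x; positivity
  have hφ : ∀ t, HasDerivAt (fun t => expNegInvGlue (δ - t) / expNegInvGlue δ)
      (-(((δ - t)⁻¹) ^ 2 * expNegInvGlue (δ - t)) / expNegInvGlue δ) t := by
    intro t
    have := ((hd (δ - t)).comp t ((hasDerivAt_id t).const_sub δ)).div_const (expNegInvGlue δ)
    simpa using this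
  refine ⟨fun t => expNegInvGlue (δ - t) / expNegInvGlue δ, ?_, ?_, ?_, ?_, ?_, ?_⟩
  · exact (expNegInvGlue.contDiff.comp (contDiff_const.sub contDiff_id)).div_const _
  · simp [hpos.ne']
  · intro t
    exact div_nonneg (expNegInvGlue.nonneg _) hpos.le
  · intro t ht
    rw [div_le_one hpos]
    exact hmono (by linarith)
  · intro t ht
    simp [expNegInvGlue.zero_of_nonpos (show δ - t ≤ 0 by linarith)]
  · intro t ht
    rw [(hφ t).deriv, neg_div, neg_neg, ← mul_div_assoc]
    refine div_le_div_of_nonneg_right ?_ hpos.le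
    rcases le_or_gt δ t with h | h
    · simp [expNegInvGlue.zero_of_nonpos (show δ - t ≤ 0 by linarith)]
    · refine mul_le_mul_of_nonneg_right ?_ (expNegInvGlue.nonneg _)
      have h1 : 0 < δ - t := by linarith
      have h2 : (δ - t) ^ 2 ≤ δ ^ 2 := by gcongr; linarith
      rw [inv_pow]
      rcases le_or_gt K 0 with hK0 | hK0
      · exact hK0.trans (by positivity)
      · rw [le_inv_comm₀ hK0 (by positivity)]
        rw [le_inv_comm₀ (by positivity) hK0]
        calc K = K * δ ^ 2 / δ ^ 2 := by field_simp
          _ ≤ 1 / δ ^ 2 := by gcongr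
          _ ≤ 1 / (δ - t) ^ 2 := by gcongr
          _ = _ := one_div _

theorem DForm.d_ofFun_eq_fderivWithin [IsManifold I ∞ M] {f : M → ℝ} {p : M}
    (hf : MDifferentiableAt I 𝓘(ℝ, ℝ) f p) (v : TangentSpace I p) :
    (DForm.ofFun (I := I) f).d p ![v] =
      fderivWithin ℝ (fun y => f ((extChartAt I p).symm y)) (range I) (extChartAt I p p) v := by
  rw [DForm.d_ofFun_apply hf, mfderiv_apply_eq_fderivWithin hf]

theorem DForm.d_ofFun_sub_apply [IsManifold I ∞ M] {f g : M → ℝ} {p : M}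
    (hf : MDifferentiableAt I 𝓘(ℝ, ℝ) f p) (hg : MDifferentiableAt I 𝓘(ℝ, ℝ) g p)
    (v : TangentSpace I p) :
    (DForm.ofFun (I := I) (fun x => f x - g x)).d p ![v] =
      (DForm.ofFun (I := I) f).d p ![v] - (DForm.ofFun (I := I) g).d p ![v] := by
  rw [DForm.d_ofFun_eq_fderivWithin (f := fun x => f x - g x) (hf.sub hg),
    DForm.d_ofFun_eq_fderivWithin hf,
    DForm.d_ofFun_eq_fderivWithin hg]
  have h1 : DifferentiableWithinAt ℝ (fun y => f ((extChartAt I p).symm y)) (range I)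
      (extChartAt I p p) := ((mdifferentiableAt_iff _ _).1 hf).2
  have h2 : DifferentiableWithinAt ℝ (fun y => g ((extChartAt I p).symm y)) (range I)
      (extChartAt I p p) := ((mdifferentiableAt_iff _ _).1 hg).2
  exact congrArg (fun L : E →L[ℝ] ℝ => L v)
    (fderivWithin_fun_sub (I.uniqueDiffOn _ (extChartAt_mem_range p p)) h1 h2)

section BoundaryFunction

variable {W : Type*} [TopologicalSpace W] [ChartedSpace (EuclideanHalfSpace 4) W]

/-- The first coordinate, which vanishes on the boundary, of the preferred chart at `c`. -/
def boundaryCoord (c p : W) : ℝ := extChartAt (𝓡∂ 4) c p 0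

theorem boundaryCoord_nonneg (c p : W) : 0 ≤ boundaryCoord c p := by
  have := extChartAt_mem_range (I := 𝓡∂ 4) c p
  rwa [range_modelWithCornersEuclideanHalfSpace] at this

variable [IsManifold (𝓡∂ 4) ∞ W]

theorem boundaryCoord_eq_zero_iff {c p : W} (hp : p ∈ (extChartAt (𝓡∂ 4) c).source) :
    boundaryCoord c p = 0 ↔ p ∈ (𝓡∂ 4).boundary W := by
  have hs := hp
  rw [extChartAt_source] at hs
  have h1 := (𝓡∂ 4).isInteriorPoint_iff_of_mem_atlas (n := ∞) (by simp) (chart_mem_atlas _ c) hs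
  have h2 : extChartAt (𝓡∂ 4) c p ∈ interior (extChartAt (𝓡∂ 4) c).target ↔
      extChartAt (𝓡∂ 4) c p ∈ interior (range (𝓡∂ 4)) :=
    ⟨fun h => OpenPartialHomeomorph.interior_extend_target_subset_interior_range _ h,
      fun h => (chartAt _ c).mem_interior_extend_target ((chartAt _ c).map_source hs) h⟩
  have h3 : (𝓡∂ 4).IsInteriorPoint p ↔ 0 < boundaryCoord c p := by
    rw [h1]
    refine h2.trans ?_
    rw [interior_range_modelWithCornersEuclideanHalfSpace]
    rfl
  change _ ↔ (𝓡∂ 4).IsBoundaryPoint p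
  rw [ModelWithCorners.isBoundaryPoint_iff_not_isInteriorPoint, h3, not_lt]
  exact ⟨fun h => h.le, fun h => le_antisymm h (boundaryCoord_nonneg c p)⟩

theorem isOutward_iff {p : W} {n : TangentSpace (𝓡∂ 4) p} :
    IsOutward p n ↔
    (EuclideanSpace.proj 0 : EuclideanSpace ℝ (Fin 4) →L[ℝ] ℝ) n < 0 := by
  have : IsManifold (𝓡∂ 4) 1 W := .of_le (n := ∞) (by simp)
  rw [IsOutward, mfderiv_extChartAt_self]
  rfl

theorem fderivWithin_nonneg_of_min {F : W → ℝ} {p : W} (hp : p ∈ (𝓡∂ 4).boundary W)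
    (hF : ∀ᶠ q in 𝓝 p, F p ≤ F q) {v : EuclideanSpace ℝ (Fin 4)} (hv : 0 ≤ v 0) :
    0 ≤ fderivWithin ℝ (fun y => F ((extChartAt (𝓡∂ 4) p).symm y)) (range (𝓡∂ 4))
      (extChartAt (𝓡∂ 4) p p) v := by
  refine IsLocalMinOn.fderivWithin_nonneg ?_ ?_
  · have := eventually_symm_of_eventually (I := 𝓡∂ 4) (mem_extChartAt_source p) hF
    filter_upwards [this] with y hy
    rwa [extChartAt_to_inv]
  · refine mem_posTangentConeAt_of_frequently_mem (Filter.Eventually.frequently ?_)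
    filter_upwards [self_mem_nhdsWithin] with t ht
    have h0 : extChartAt (𝓡∂ 4) p p 0 = 0 :=
      (boundaryCoord_eq_zero_iff (mem_extChartAt_source p)).2 hp
    rw [range_modelWithCornersEuclideanHalfSpace]
    simp only [mem_ofPred_eq, PiLp.add_apply, PiLp.smul_apply, h0, smul_eq_mul, zero_add]
    exact mul_nonneg (le_of_lt ht) hv

theorem d_ofFun_outward_le {F G : W → ℝ} {p : W} (hp : p ∈ (𝓡∂ 4).boundary W)
    (hF : MDifferentiableAt (𝓡∂ 4) 𝓘(ℝ, ℝ) F p) (hG : MDifferentiableAt (𝓡∂ 4) 𝓘(ℝ, ℝ) G p)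
    (hle : ∀ᶠ q in 𝓝 p, F q ≤ G q) (heq : F p = G p) {n : TangentSpace (𝓡∂ 4) p}
    (hn : IsOutward p n) :
    (DForm.ofFun (I := 𝓡∂ 4) G).d p ![n] ≤ (DForm.ofFun (I := 𝓡∂ 4) F).d p ![n] := by
  let n' : EuclideanSpace ℝ (Fin 4) := n
  have hn' : n' 0 < 0 := isOutward_iff.1 hn
  have h1 := fderivWithin_nonneg_of_min (F := fun q => G q - F q) hp
    (hle.mono fun q hq => by linarith) (v := -n') (by
      rw [PiLp.neg_apply]; linarith)
  have h2 := DForm.d_ofFun_sub_apply hG hF n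
  rw [DForm.d_ofFun_eq_fderivWithin (f := fun q => G q - F q) (hG.sub hF)] at h2
  rw [map_neg] at h1
  exact sub_nonpos.1 (neg_nonneg.1 (h1.trans_eq (congrArg (fun t : ℝ => -t) h2)))

theorem contMDiffAt_boundaryCoord {c p : W} (hp : p ∈ (extChartAt (𝓡∂ 4) c).source) :
    ContMDiffAt (𝓡∂ 4) 𝓘(ℝ, ℝ) ∞ (boundaryCoord c) p := by
  rw [extChartAt_source] at hp
  have h := contMDiffAt_extChartAt' (I := 𝓡∂ 4) (n := ∞) hp
  exact (EuclideanSpace.proj (𝕜 := ℝ) (0 : Fin 4)).contDiff.contMDiff.contMDiffAt.comp p h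

theorem d_ofFun_boundaryCoord_neg {c p : W} (hp : p ∈ (extChartAt (𝓡∂ 4) c).source)
    (hpb : p ∈ (𝓡∂ 4).boundary W) {n : TangentSpace (𝓡∂ 4) p} (hn : IsOutward p n) :
    (DForm.ofFun (I := 𝓡∂ 4) (boundaryCoord c)).d p ![n] < 0 := by
  have : IsManifold (𝓡∂ 4) 1 W := .of_le (n := ∞) (by simp)
  have hs := hp
  rw [extChartAt_source] at hs
  have hmd := (contMDiffAt_boundaryCoord hp).mdifferentiableAt (by simp)
  have hmin : ∀ᶠ q in 𝓝 p, boundaryCoord c p ≤ boundaryCoord c q := by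
    rw [(boundaryCoord_eq_zero_iff hp).2 hpb]
    exact Filter.Eventually.of_forall fun q => boundaryCoord_nonneg c q
  rw [DForm.d_ofFun_eq_fderivWithin hmd]
  obtain ⟨w, hw⟩ : ∃ w : TangentSpace (𝓡∂ 4) p,
      fderivWithin ℝ (fun y => boundaryCoord c ((extChartAt (𝓡∂ 4) p).symm y)) (range (𝓡∂ 4))
        (extChartAt (𝓡∂ 4) p p) w = 1 := by
    obtain ⟨w, hw⟩ := (isInvertible_mfderiv_extChartAt hp).bijective.2
      (EuclideanSpace.single (0 : Fin 4) (1 : ℝ))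
    refine ⟨w, ?_⟩
    rw [← mfderiv_apply_eq_fderivWithin hmd]
    have h1 := mfderiv_comp (I := 𝓡∂ 4) (I'' := 𝓘(ℝ, ℝ)) p
      ((EuclideanSpace.proj (𝕜 := ℝ) (0 : Fin 4)).differentiableAt.mdifferentiableAt)
      (mdifferentiableAt_extChartAt (I := 𝓡∂ 4) hs)
    rw [mfderiv_eq_fderiv, ContinuousLinearMap.fderiv] at h1
    have h2 := congrArg (fun L : EuclideanSpace ℝ (Fin 4) →L[ℝ] ℝ => L w) h1
    refine h2.trans ?_
    change (EuclideanSpace.proj (𝕜 := ℝ) (0 : Fin 4))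
      (mfderiv (𝓡∂ 4) 𝓘(ℝ, EuclideanSpace ℝ (Fin 4)) (extChartAt (𝓡∂ 4) c) p w) = 1
    rw [hw]
    simp
  generalize hD : fderivWithin ℝ (fun y => boundaryCoord c ((extChartAt (𝓡∂ 4) p).symm y))
    (range (𝓡∂ 4)) (extChartAt (𝓡∂ 4) p p) = D at hw ⊢
  have hnn : ∀ v : EuclideanSpace ℝ (Fin 4), 0 ≤ v 0 → 0 ≤ D v := fun v hv => by
    rw [← hD]; exact fderivWithin_nonneg_of_min hpb hmin hv
  let n' : EuclideanSpace ℝ (Fin 4) := n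
  let w' : EuclideanSpace ℝ (Fin 4) := w
  change D n' < 0
  have hn' : n' 0 < 0 := isOutward_iff.1 hn
  have hw' : D w' = 1 := hw
  by_contra hcon
  have h0 : D n' = 0 := le_antisymm (by
    have := hnn (-n') (by rw [PiLp.neg_apply]; linarith)
    rw [map_neg] at this; linarith) (not_lt.1 hcon)
  have e0 : (w' - (w' 0 / n' 0) • n') 0 = 0 := by
    rw [PiLp.sub_apply, PiLp.smul_apply, smul_eq_mul, div_mul_cancel₀ _ hn'.ne, sub_self]
  have h1 := hnn (-(w' - (w' 0 / n' 0) • n')) (by rw [PiLp.neg_apply, e0, neg_zero])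
  rw [map_neg, map_sub, map_smul, h0, smul_zero, hw'] at h1
  linarith

/-- A smooth function which is positive off the boundary, and zero with nonzero derivative on the
boundary. -/
theorem exists_boundary_function [T2Space W] [CompactSpace W] :
    ∃ ρ : W → ℝ, ContMDiff (𝓡∂ 4) 𝓘(ℝ, ℝ) ∞ ρ ∧ (∀ p, 0 ≤ ρ p) ∧
      (∀ p, ρ p = 0 ↔ p ∈ (𝓡∂ 4).boundary W) ∧
      ∀ p ∈ (𝓡∂ 4).boundary W, ∀ n : TangentSpace (𝓡∂ 4) p, IsOutward p n →
        (DForm.ofFun (I := 𝓡∂ 4) ρ).d p ![n] < 0 := by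
  obtain ⟨t, -, ht⟩ := isCompact_univ.elim_nhds_subcover
    (fun c : W => (extChartAt (𝓡∂ 4) c).source) fun c _ => extChartAt_source_mem_nhds c
  obtain ⟨f, hf⟩ := SmoothPartitionOfUnity.exists_isSubordinate (𝓡∂ 4) isClosed_univ
    (fun c : t => (extChartAt (𝓡∂ 4) (c : W)).source)
    (fun c => isOpen_extChartAt_source (c : W)) (fun p hp => by
      obtain ⟨c, hc, hpc⟩ := mem_iUnion₂.1 (ht hp)
      exact mem_iUnion.2 ⟨⟨c, hc⟩, hpc⟩)
  have hsrc : ∀ (c : t) (p : W), f c p ≠ 0 → p ∈ (extChartAt (𝓡∂ 4) (c : W)).source :=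
    fun c p h => hf c (subset_tsupport _ h)
  have hterm : ∀ (c : t) (p : W), 0 ≤ f c p * boundaryCoord (c : W) p := fun c p =>
    mul_nonneg (f.nonneg c p) (boundaryCoord_nonneg _ _)
  have hex : ∀ p : W, ∃ c : t, 0 < f c p := fun p => by
    obtain ⟨c, hc⟩ := f.exists_pos_of_mem (mem_univ p)
    exact ⟨c, hc⟩
  have hsm : ContMDiff (𝓡∂ 4) 𝓘(ℝ, ℝ) ∞ fun p => ∑ c : t, f c p * boundaryCoord (c : W) p := by
    refine contMDiff_finsetSum fun c _ => ?_
    exact f.contMDiff_smul fun p hp => contMDiffAt_boundaryCoord (hf c hp)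
  have hzero : ∀ p ∈ (𝓡∂ 4).boundary W, ∑ c : t, f c p * boundaryCoord (c : W) p = 0 := by
    intro p hp
    refine Finset.sum_eq_zero fun c _ => ?_
    by_cases h : f c p = 0
    · rw [h, zero_mul]
    · rw [(boundaryCoord_eq_zero_iff (hsrc c p h)).2 hp, mul_zero]
  refine ⟨fun p => ∑ c : t, f c p * boundaryCoord (c : W) p, hsm,
    fun p => Finset.sum_nonneg fun c _ => hterm c p, fun p => ⟨fun h => ?_, hzero p⟩, ?_⟩
  · obtain ⟨c, hc⟩ := hex p
    have h1 := (Finset.sum_eq_zero_iff_of_nonneg fun c _ => hterm c p).1 h c (Finset.mem_univ c)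
    exact (boundaryCoord_eq_zero_iff (hsrc c p hc.ne')).1 ((mul_eq_zero.1 h1).resolve_left hc.ne')
  · intro p hp n hn
    obtain ⟨c, hc⟩ := hex p
    have hpc := hsrc c p hc.ne'
    have hb := (contMDiffAt_boundaryCoord hpc).mdifferentiableAt (by simp)
    have hφ : DifferentiableAt ℝ (fun s : ℝ => f c p / 2 * s) (boundaryCoord (c : W) p) := by
      fun_prop
    have h1 := d_ofFun_outward_le (F := fun q => f c p / 2 * boundaryCoord (c : W) q)
      (G := fun q => ∑ c : t, f c q * boundaryCoord (c : W) q) hp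
      (hφ.mdifferentiableAt.comp p hb) (hsm.mdifferentiableAt (by simp))
      (by
        have : ∀ᶠ q in 𝓝 p, f c p / 2 < f c q :=
          (f c).contMDiff.continuous.continuousAt.eventually (lt_mem_nhds (by linarith))
        filter_upwards [this] with q hq
        refine le_trans ?_ (Finset.single_le_sum (fun c _ => hterm c q) (Finset.mem_univ c))
        exact mul_le_mul_of_nonneg_right hq.le (boundaryCoord_nonneg _ _))
      (by rw [hzero p hp, (boundaryCoord_eq_zero_iff hpc).2 hp, mul_zero]) hn
    refine h1.trans_lt ?_
    rw [DForm.d_ofFun_comp_apply (φ := fun s => f c p / 2 * s) hφ hb]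
    refine mul_neg_of_pos_of_neg ?_ (d_ofFun_boundaryCoord_neg hpc hp hn)
    rw [deriv_const_mul _ differentiableAt_id]
    simpa using hc

end BoundaryFunction

/-- A smooth self-map of a finite dimensional space with derivative the identity has, near the
point, a smooth local inverse. -/
theorem exists_smooth_local_inverse {X : Type*} [NormedAddCommGroup X] [NormedSpace ℝ X]
    [CompleteSpace X] {G : X → X} {O : Set X} {y₀ : X} (hO : IsOpen O) (hy₀ : y₀ ∈ O)
    (hG : ContDiffOn ℝ ∞ G O) (hd : HasFDerivAt G (ContinuousLinearMap.id ℝ X) y₀) :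
    ∃ (T : Set X) (g : X → X), IsOpen T ∧ y₀ ∈ T ∧ T ⊆ O ∧ IsOpen (G '' T) ∧
      (∀ y ∈ T, g (G y) = y) ∧ ∀ z ∈ G '' T, ContDiffAt ℝ ∞ g z := by
  have hd' : HasFDerivAt G ((ContinuousLinearEquiv.refl ℝ X : X ≃L[ℝ] X) : X →L[ℝ] X) y₀ := hd
  have hGa : ∀ y ∈ O, ContDiffAt ℝ ∞ G y := fun y hy => hG.contDiffAt (hO.mem_nhds hy)
  let Φ := (hGa y₀ hy₀).toOpenPartialHomeomorph G hd' (by simp)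
  have hΦ : ⇑Φ = G := (hGa y₀ hy₀).toOpenPartialHomeomorph_coe hd' (by simp)
  have hΦ₀ : y₀ ∈ Φ.source := (hGa y₀ hy₀).mem_toOpenPartialHomeomorph_source hd' (by simp)
  have hcont : ContinuousAt (fderiv ℝ G) y₀ :=
    ((hGa y₀ hy₀).fderiv_right (m := ∞) (by simp)).continuousAt
  have hnear : ∀ᶠ y in 𝓝 y₀, fderiv ℝ G y ∈ range ((↑) : (X ≃L[ℝ] X) → X →L[ℝ] X) := by
    refine hcont.eventually (IsOpen.mem_nhds ContinuousLinearEquiv.isOpen ?_)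
    exact ⟨ContinuousLinearEquiv.refl ℝ X, hd'.fderiv.symm⟩
  obtain ⟨S, hS, hSo, hyS⟩ := eventually_nhds_iff.1 hnear
  have hT : IsOpen (Φ.source ∩ (O ∩ S)) := Φ.open_source.inter (hO.inter hSo)
  refine ⟨Φ.source ∩ (O ∩ S), Φ.symm, hT, ⟨hΦ₀, hy₀, hyS⟩, fun y hy => hy.2.1, ?_, ?_, ?_⟩
  · rw [← hΦ]
    exact Φ.isOpen_image_of_subset_source hT inter_subset_left
  · intro y hy
    rw [← hΦ]
    exact Φ.left_inv hy.1
  · rintro _ ⟨y, hy, rfl⟩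
    obtain ⟨A, hA⟩ := hS y hy.2.2
    have hinv : Φ.symm (G y) = y := by rw [← hΦ]; exact Φ.left_inv hy.1
    have hyd : HasFDerivAt G (A : X →L[ℝ] X) y := by
      rw [hA]; exact ((hGa y hy.2.1).differentiableAt (by simp)).hasFDerivAt
    refine Φ.contDiffAt_symm (f₀' := A) ?_ ?_ ?_
    · rw [← hΦ]; exact Φ.map_source hy.1
    · rw [hinv, hΦ]; exact hyd
    · rw [hinv, hΦ]; exact hGa y hy.2.1

section Extension

variable {W : Type*} [TopologicalSpace W] [ChartedSpace (EuclideanHalfSpace 4) W]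
  [IsManifold (𝓡∂ 4) ∞ W]
  {V : Type*} [TopologicalSpace V] [ChartedSpace (EuclideanSpace ℝ (Fin 3)) V]
  [IsManifold (𝓡 3) ∞ V]

/-- An embedding has, locally, a smooth left inverse. -/
theorem IsBoundaryInclusion.exists_local_retraction {ι : V → W} (hι : IsBoundaryInclusion ι)
    (x₀ : V) : ∃ (O : Set W) (π : W → V), IsOpen O ∧ ι x₀ ∈ O ∧
      (∀ p ∈ O, ContMDiffAt (𝓡∂ 4) (𝓡 3) ∞ π p) ∧ ∀ x, ι x ∈ O → π (ι x) = x := by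
  let e := extChartAt (𝓡 3) x₀
  let e' := extChartAt (𝓡∂ 4) (ι x₀)
  let A : EuclideanSpace ℝ (Fin 3) →L[ℝ] EuclideanSpace ℝ (Fin 4) := mfderiv (𝓡 3) (𝓡∂ 4) ι x₀
  have hA : Function.Injective A := hι.immersion x₀
  obtain ⟨L', hL'⟩ := A.toLinearMap.exists_leftInverse_of_injective (LinearMap.ker_eq_bot.2 hA)
  let L : EuclideanSpace ℝ (Fin 4) →L[ℝ] EuclideanSpace ℝ (Fin 3) := L'.toContinuousLinearMap
  have hLA : L.comp A = ContinuousLinearMap.id ℝ _ := by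
    ext1 v
    exact congrArg (fun B : EuclideanSpace ℝ (Fin 3) →ₗ[ℝ] EuclideanSpace ℝ (Fin 3) => B v) hL'
  let F : EuclideanSpace ℝ (Fin 3) → EuclideanSpace ℝ (Fin 4) := fun y => e' (ι (e.symm y))
  let O₁ : Set (EuclideanSpace ℝ (Fin 3)) := e.target ∩ e.symm ⁻¹' (ι ⁻¹' e'.source)
  have het : IsOpen e.target := isOpen_extChartAt_target x₀
  have hO₁ : IsOpen O₁ := (continuousOn_extChartAt_symm x₀).isOpen_inter_preimage het
    ((isOpen_extChartAt_source (ι x₀)).preimage hι.smooth.continuous)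
  have hr : range (𝓡 3) = univ := (𝓡 3).range_eq_univ
  have hF : ContDiffOn ℝ ∞ F O₁ := by
    intro y hy
    have h1 := contDiffWithinAt_writtenInChart (I := 𝓡 3) (J := 𝓡∂ 4) (x₁ := x₀) (z₁ := ι x₀)
      (p := e.symm y) (e.map_target hy.1) hι.smooth.contMDiffAt hy.2
    rw [e.right_inv hy.1] at h1
    exact h1.mono (by rw [hr]; exact subset_univ _)
  have hy₀ : e x₀ ∈ O₁ := ⟨mem_extChartAt_target x₀, by
    rw [mem_preimage, extChartAt_to_inv]; exact mem_extChartAt_source (ι x₀)⟩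
  have hFd : HasFDerivAt F A (e x₀) := by
    have h1 := (hF.contDiffAt (hO₁.mem_nhds hy₀)).differentiableAt (by simp)
    have h2 : A = fderiv ℝ F (e x₀) := by
      have h3 := (hι.smooth.mdifferentiableAt (by simp) (x := x₀)).mfderiv
      rw [hr, fderivWithin_univ] at h3
      exact h3
    rw [h2]
    exact h1.hasFDerivAt
  obtain ⟨T, g, hTo, hyT, hTO, hGT, hgG, hg⟩ := exists_smooth_local_inverse (G := fun y => L (F y))
    hO₁ hy₀ (L.contDiff.comp_contDiffOn hF) (by
      rw [← hLA]; exact L.hasFDerivAt.comp (e x₀) hFd)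
  obtain ⟨N₂, hN₂, hN₂'⟩ := hι.embedding.isInducing.isOpen_iff.1
    ((continuousOn_extChartAt (I := 𝓡 3) x₀).isOpen_inter_preimage (isOpen_extChartAt_source x₀)
      hTo)
  have hN₁ : IsOpen (e'.source ∩ e' ⁻¹' (L ⁻¹' ((fun y => L (F y)) '' T))) :=
    (continuousOn_extChartAt (ι x₀)).isOpen_inter_preimage (isOpen_extChartAt_source (ι x₀))
      (hGT.preimage L.continuous)
  have hmem : ∀ x, ι x ∈ N₂ → x ∈ e.source ∧ e x ∈ T := fun x hx => by
    have : x ∈ ι ⁻¹' N₂ := hx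
    rwa [hN₂'] at this
  refine ⟨(e'.source ∩ e' ⁻¹' (L ⁻¹' ((fun y => L (F y)) '' T))) ∩ N₂,
    fun p => e.symm (g (L (e' p))), hN₁.inter hN₂, ⟨⟨mem_extChartAt_source (ι x₀), ?_⟩, ?_⟩, ?_, ?_⟩
  · refine ⟨e x₀, hyT, ?_⟩
    simp only [F, e, extChartAt_to_inv]
  · have : x₀ ∈ ι ⁻¹' N₂ := by rw [hN₂']; exact ⟨mem_extChartAt_source x₀, hyT⟩
    exact this
  · rintro p ⟨⟨hp1, hp2⟩, -⟩
    have hgT : g (L (e' p)) ∈ T := by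
      obtain ⟨y, hy, hyp⟩ := hp2
      rw [← hyp]
      simpa only [hgG y hy] using hy
    have h1 : ContMDiffAt (𝓡∂ 4) 𝓘(ℝ, EuclideanSpace ℝ (Fin 4)) ∞ e' p := by
      rw [extChartAt_source] at hp1
      exact contMDiffAt_extChartAt' hp1
    have h2 : ContMDiffAt (𝓡∂ 4) 𝓘(ℝ, EuclideanSpace ℝ (Fin 3)) ∞ (fun p => g (L (e' p))) p :=
      ((hg _ hp2).comp (e' p) L.contDiff.contDiffAt).contMDiffAt.comp p h1
    have h3 : ContMDiffAt 𝓘(ℝ, EuclideanSpace ℝ (Fin 3)) (𝓡 3) ∞ e.symm (g (L (e' p))) :=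
      (contMDiffOn_extChartAt_symm x₀).contMDiffAt (het.mem_nhds (hTO hgT).1)
    exact h3.comp p h2
  · rintro x ⟨-, hx⟩
    obtain ⟨h1, h2⟩ := hmem x hx
    have h3 := hgG (e x) h2
    simp only [F, e.left_inv h1] at h3
    change e.symm (g (L (e' (ι x)))) = x
    rw [h3, e.left_inv h1]

theorem IsBoundaryInclusion.exists_local_extension {ι : V → W} (hι : IsBoundaryInclusion ι)
    {lam : DForm (𝓡 3) V 1} (hlam : lam.Smooth) (p₀ : W) :
    ∃ (O : Set W) (μ : DForm (𝓡∂ 4) W 1), IsOpen O ∧ (p₀ ∈ (𝓡∂ 4).boundary W → p₀ ∈ O) ∧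
      (∀ p ∈ O, μ.SmoothAt p) ∧
      ∀ x, ι x ∈ O → DForm.pullback (I := 𝓡 3) ι μ x = lam x := by
  by_cases hp₀ : p₀ ∈ (𝓡∂ 4).boundary W
  · rw [← hι.range_eq] at hp₀
    obtain ⟨x₀, rfl⟩ := hp₀
    obtain ⟨O, π, hO, hx₀, hπ, hπι⟩ := hι.exists_local_retraction x₀
    refine ⟨O, DForm.pullback π lam, hO, fun _ => hx₀, fun p hp =>
      DForm.SmoothAt.pullback (DForm.smooth_iff.1 hlam _) (hπ p hp), fun x hx => ?_⟩
    have h1 := mfderiv_comp (I'' := 𝓡 3) x ((hπ _ hx).mdifferentiableAt (by simp))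
      (hι.smooth.mdifferentiableAt (by simp))
    have h2 : π ∘ ι =ᶠ[𝓝 x] id := by
      filter_upwards [(hO.preimage hι.smooth.continuous).mem_nhds hx] with y hy
      exact hπι y hy
    rw [h2.mfderiv_eq, mfderiv_id] at h1
    ext v
    rw [DForm.pullback_apply, DForm.pullback_apply]
    refine DForm.apply_congr_point lam (hπι x hx) _ _ ?_
    funext i
    exact (congrArg (fun B : EuclideanSpace ℝ (Fin 3) →L[ℝ] EuclideanSpace ℝ (Fin 3) => B (v i))
      h1).symm
  · exact ⟨∅, fun _ => 0, isOpen_empty, fun h => absurd h hp₀, fun _ h => absurd h (by simp),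
      fun _ h => absurd h (by simp)⟩

/-- A 1-form on the boundary is the restriction of a 1-form on the whole manifold. -/
theorem IsBoundaryInclusion.exists_extension [T2Space W] [CompactSpace W] {ι : V → W}
    (hι : IsBoundaryInclusion ι) {lam : DForm (𝓡 3) V 1} (hlam : lam.Smooth) :
    ∃ μ : DForm (𝓡∂ 4) W 1, (∀ p, μ.SmoothAt p) ∧
      ∀ x, DForm.pullback (I := 𝓡 3) ι μ x = lam x := by
  choose O μ hO hpO hμ hμι using hι.exists_local_extension hlam
  have hcl : IsClosed ((𝓡∂ 4).boundary W) := (𝓡∂ 4).isClosed_boundary (n := ∞) (by simp)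
  obtain ⟨t, -, ht⟩ := hcl.isCompact.elim_nhds_subcover O
    fun p hp => (hO p).mem_nhds (hpO p hp)
  obtain ⟨f, hf⟩ := SmoothPartitionOfUnity.exists_isSubordinate (𝓡∂ 4) hcl
    (fun c : t => O c) (fun c => hO c) (fun p hp => by
      obtain ⟨c, hc, hpc⟩ := mem_iUnion₂.1 (ht hp)
      exact mem_iUnion.2 ⟨⟨c, hc⟩, hpc⟩)
  refine ⟨fun p => ∑ c : t, f c p • μ c p, fun p => DForm.SmoothAt.sum fun c _ => ?_, fun x => ?_⟩
  · by_cases hp : p ∈ tsupport (f c)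
    · exact DForm.SmoothAt.smul (f c).contMDiff.contMDiffAt (hμ c p (hf c hp))
    · refine (DForm.smoothAt_zero p).congr ?_
      filter_upwards [(isClosed_tsupport (f c)).isOpen_compl.mem_nhds hp] with q hq
      rw [image_eq_zero_of_notMem_tsupport hq, zero_smul]
  · have hx : ι x ∈ (𝓡∂ 4).boundary W := by rw [← hι.range_eq]; exact mem_range_self x
    have hsum : ∑ c : t, f c (ι x) = 1 := by
      rw [← finsum_eq_sum_of_fintype]; exact f.sum_eq_one hx
    ext v
    rw [DForm.pullback_apply]
    have h1 : ∀ c : t, f c (ι x) * μ c (ι x) (fun i => mfderiv (𝓡 3) (𝓡∂ 4) ι x (v i)) =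
        f c (ι x) * lam x v := by
      intro c
      by_cases h : f c (ι x) = 0
      · rw [h, zero_mul, zero_mul]
      · rw [← hμι c x (hf c (subset_tsupport _ h))]
        rfl
    have h2 : (∑ c : t, f c (ι x) • μ c (ι x)) (fun i => mfderiv (𝓡 3) (𝓡∂ 4) ι x (v i)) =
        ∑ c : t, f c (ι x) * μ c (ι x) (fun i => mfderiv (𝓡 3) (𝓡∂ 4) ι x (v i)) := by
      simp [ContinuousAlternatingMap.sum_apply]
    rw [h2, Finset.sum_congr rfl fun c _ => h1 c, ← Finset.sum_mul, hsum, one_mul]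

end Extension

theorem DForm.d_const_smul [IsManifold I ∞ M] (t : ℝ) (σ : DForm I M k) (p : M) :
    DForm.d (I := I) (k := k) (fun x => t • σ x) p = t • σ.d p := by
  ext v
  have h := extDerivWithin_smul t (σ.inChart p) (I.uniqueDiffOn _ (extChartAt_mem_range p p))
  rw [ContinuousAlternatingMap.smul_apply, DForm.d_apply, DForm.d_apply]
  exact congrArg (fun L : E [⋀^Fin (k + 1)]→L[ℝ] ℝ => L v) h

theorem DForm.SmoothAt.const_smul {σ : DForm I M k} {p : M} (t : ℝ) (hσ : σ.SmoothAt p) :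
    DForm.SmoothAt (I := I) (k := k) (fun x => t • σ x) p :=
  ContDiffWithinAt.const_smul t hσ

theorem DForm.d_zero [IsManifold I ∞ M] (p : M) :
    DForm.d (I := I) (k := k) (fun _ => 0) p = 0 := by
  have := DForm.d_const_smul (I := I) (k := k) 0 (fun _ => 0) p
  simpa using this

theorem DForm.d_ofFun_const [IsManifold I ∞ M] (t : ℝ) (p : M) (v : TangentSpace I p) :
    (DForm.ofFun (I := I) fun _ : M => t).d p ![v] = 0 := by
  rw [DForm.d_ofFun_apply mdifferentiableAt_const, mfderiv_const]
  rfl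

theorem DForm.pullback_apply_one (f : M → N) (σ : DForm J N 1) (x : M) (v : TangentSpace I x) :
    DForm.pullback (I := I) f σ x ![v] = σ (f x) ![mfderiv I J f x v] := by
  rw [DForm.pullback_apply]
  exact congrArg _ (by funext i; fin_cases i; rfl)

theorem DForm.pullback_apply_two (f : M → N) (σ : DForm J N 2) (x : M) (v w : TangentSpace I x) :
    DForm.pullback (I := I) f σ x ![v, w] =
      σ (f x) ![mfderiv I J f x v, mfderiv I J f x w] := by
  rw [DForm.pullback_apply]
  exact congrArg _ (by funext i; fin_cases i <;> rfl)

theorem DForm.d_ofFun_comp_map [IsManifold I ∞ M] [IsManifold J ∞ N] {f : M → N} {ρ : N → ℝ}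
    {x : M} (hf : ContMDiffAt I J ∞ f x) (hρ : ContMDiffAt J 𝓘(ℝ, ℝ) ∞ ρ (f x))
    (v : TangentSpace I x) : (DForm.ofFun (I := J) ρ).d (f x) ![mfderiv I J f x v] =
      (DForm.ofFun (I := I) fun y => ρ (f y)).d x ![v] := by
  rw [← DForm.pullback_apply_one, ← DForm.d_pullback (DForm.smoothAt_ofFun hρ) hf]
  rfl

/-- The components of the forms in a frame obey the bounds. -/
def HasFrameBound (s l : DForm I M 2) (r m a : DForm I M 1) (c B : ℝ) (q : M) : Prop :=
  ∃ e : Fin 4 → TangentSpace I q, FrameBound (fun i j => s q ![e i, e j])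
    (fun i j => l q ![e i, e j]) (fun i => r q ![e i]) (fun i => m q ![e i])
    (fun i => a q ![e i]) c B

theorem exists_eventually_hasFrameBound [IsManifold I ∞ M] {s l : DForm I M 2} {r m a : DForm I M 1}
    {p : M} (hs : s.SmoothAt p) (hl : l.SmoothAt p) (hr : r.SmoothAt p) (hm : m.SmoothAt p)
    (ha : a.SmoothAt p) (e : Fin 4 → TangentSpace I p)
    (h₀ : 0 < pf fun i j => s p ![e i, e j])
    (h₁ : 0 < -pfPair (fun i j => s p ![e i, e j])
      (wedgeMatrix (fun i => r p ![e i]) fun i => m p ![e i]))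
    (h₂ : 0 < -pfPair (fun i j => l p ![e i, e j])
      (wedgeMatrix (fun i => r p ![e i]) fun i => m p ![e i])) :
    ∃ c B : ℝ, 0 < c ∧ ∀ᶠ q in 𝓝 p, HasFrameBound s l r m a c B q := by
  have : IsManifold I 1 M := .of_le (n := ∞) (by simp)
  let F : ∀ q : M, Fin 4 → TangentSpace I q := fun q i =>
    (mfderivWithin 𝓘(ℝ, E) I (extChartAt I p).symm (range I) (extChartAt I p q) (e i) : E)
  have hFp : F p = e := by
    funext i
    exact congrArg (fun L : E →L[ℝ] E => L (e i))
      (mfderivWithin_range_extChartAt_symm (I := I) (x := p))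
  have c1 : ∀ {ω₁ : DForm I M 1}, ω₁.SmoothAt p → ∀ i, ContinuousAt (fun q => ω₁ q ![F q i]) p := by
    intro ω₁ h i
    refine (h.continuousAt_apply (fun _ => (e i : E))).congr
      (Filter.Eventually.of_forall fun q => ?_)
    exact DForm.apply_congr_point ω₁ rfl _ _ (by funext j; fin_cases j; rfl)
  have c2 : ∀ {ω₁ : DForm I M 2}, ω₁.SmoothAt p → ∀ i j,
      ContinuousAt (fun q => ω₁ q ![F q i, F q j]) p := by
    intro ω₁ h i j
    refine (h.continuousAt_apply ![(e i : E), (e j : E)]).congr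
      (Filter.Eventually.of_forall fun q => ?_)
    exact DForm.apply_congr_point ω₁ rfl _ _ (by funext j; fin_cases j <;> rfl)
  have cS := c2 hs
  have cL := c2 hl
  have cr := c1 hr
  have cm := c1 hm
  have ca := c1 ha
  have k₀ : ContinuousAt (fun q => pf fun i j => s q ![F q i, F q j]) p := by
    unfold pf; fun_prop
  have k₁ : ContinuousAt (fun q => -pfPair (fun i j => s q ![F q i, F q j])
      (wedgeMatrix (fun i => r q ![F q i]) fun i => m q ![F q i])) p := by
    unfold pfPair wedgeMatrix; fun_prop
  have k₂ : ContinuousAt (fun q => -pfPair (fun i j => l q ![F q i, F q j])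
      (wedgeMatrix (fun i => r q ![F q i]) fun i => m q ![F q i])) p := by
    unfold pfPair wedgeMatrix; fun_prop
  have k₃ : ContinuousAt (fun q => |pf fun i j => l q ![F q i, F q j]|) p := by
    unfold pf; fun_prop
  have k₄ : ContinuousAt (fun q => |pfPair (fun i j => s q ![F q i, F q j])
      fun i j => l q ![F q i, F q j]|) p := by
    unfold pfPair; fun_prop
  have k₅ : ContinuousAt (fun q => |pfPair (fun i j => s q ![F q i, F q j])
      (wedgeMatrix (fun i => r q ![F q i]) fun i => a q ![F q i])|) p := by
    unfold pfPair wedgeMatrix; fun_prop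
  have k₆ : ContinuousAt (fun q => |pfPair (fun i j => l q ![F q i, F q j])
      (wedgeMatrix (fun i => r q ![F q i]) fun i => a q ![F q i])|) p := by
    unfold pfPair wedgeMatrix; fun_prop
  rw [← hFp] at h₀ h₁ h₂
  obtain ⟨c, hc, hc'⟩ := exists_between (lt_min h₁ h₂)
  obtain ⟨hc₁, hc₂⟩ := lt_min_iff.1 hc'
  obtain ⟨B, hB⟩ := exists_gt (max (max |pf fun i j => l p ![F p i, F p j]|
    |pfPair (fun i j => s p ![F p i, F p j]) fun i j => l p ![F p i, F p j]|)
    (max |pfPair (fun i j => s p ![F p i, F p j])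
      (wedgeMatrix (fun i => r p ![F p i]) fun i => a p ![F p i])|
    |pfPair (fun i j => l p ![F p i, F p j])
      (wedgeMatrix (fun i => r p ![F p i]) fun i => a p ![F p i])|))
  simp only [max_lt_iff] at hB
  refine ⟨c, B, hc, ?_⟩
  filter_upwards [k₀.eventually (lt_mem_nhds h₀), k₁.eventually (lt_mem_nhds hc₁),
    k₂.eventually (lt_mem_nhds hc₂), k₃.eventually (gt_mem_nhds hB.1.1),
    k₄.eventually (gt_mem_nhds hB.1.2), k₅.eventually (gt_mem_nhds hB.2.1),
    k₆.eventually (gt_mem_nhds hB.2.2)] with q q₀ q₁ q₂ q₃ q₄ q₅ q₆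
  exact ⟨F q, q₀, q₁.le, q₂.le, q₃.le, q₄.le, q₅.le, q₆.le⟩

theorem IsCompact.exists_hasFrameBound {s l : DForm I M 2} {r m a : DForm I M 1} {S : Set M}
    (hS : IsCompact S)
    (h : ∀ p ∈ S, ∃ c B : ℝ, 0 < c ∧ ∀ᶠ q in 𝓝 p, HasFrameBound s l r m a c B q) :
    ∃ c B : ℝ, 0 < c ∧ ∃ O : Set M, IsOpen O ∧ S ⊆ O ∧ ∀ q ∈ O, HasFrameBound s l r m a c B q := by
  refine hS.induction_on (p := fun S => ∃ c B : ℝ, 0 < c ∧ ∃ O : Set M, IsOpen O ∧ S ⊆ O ∧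
    ∀ q ∈ O, HasFrameBound s l r m a c B q) ?_ ?_ ?_ ?_
  · exact ⟨1, 0, one_pos, ∅, isOpen_empty, Subset.rfl, fun _ h => absurd h (by simp)⟩
  · rintro S T hST ⟨c, B, hc, O, hO, hTO, hq⟩
    exact ⟨c, B, hc, O, hO, hST.trans hTO, hq⟩
  · rintro S T ⟨c, B, hc, O, hO, hTO, hq⟩ ⟨c', B', hc', O', hO', hTO', hq'⟩
    refine ⟨min c c', max B B', lt_min hc hc', O ∪ O', hO.union hO', union_subset_union hTO hTO',
      ?_⟩
    rintro q (h | h)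
    · obtain ⟨e, he⟩ := hq q h
      exact ⟨e, he.mono (min_le_left _ _) (le_max_left _ _)⟩
    · obtain ⟨e, he⟩ := hq' q h
      exact ⟨e, he.mono (min_le_right _ _) (le_max_right _ _)⟩
  · intro p hp
    obtain ⟨c, B, hc, hq⟩ := h p hp
    obtain ⟨O, hO, hOo, hpO⟩ := eventually_nhds_iff.1 hq
    exact ⟨O, mem_nhdsWithin_of_mem_nhds (hOo.mem_nhds hpO), c, B, hc, O, hOo, Subset.rfl, hO⟩

section Filling

variable {W : Type*} [TopologicalSpace W] [ChartedSpace (EuclideanHalfSpace 4) W]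
  {V : Type*} [TopologicalSpace V] [ChartedSpace (EuclideanSpace ℝ (Fin 3)) V]

/-- Where a 2-form is positive on the contact planes, so is the differential of every contact form
that defines them. -/
theorem ContactStructure.IsDefinedBy.d_pos {ξ : ContactStructure V} {lam : DForm (𝓡 3) V 1}
    (hlam : ξ.IsDefinedBy lam) {ι : V → W} {σ : DForm (𝓡∂ 4) W 2} (hσ : PositiveOn σ ι ξ) {x : V}
    {u v : TangentSpace (𝓡 3) x} (huv : ξ.PosFrame x u v) : 0 < lam.d x ![u, v] := by
  obtain ⟨hu, hv, lam', hlam', hpos⟩ := id huv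
  rcases lt_trichotomy (lam.d x ![u, v]) 0 with h | h | h
  · have h1 : 0 < lam.d x ![v, u] := by
      have : lam.d x ![v, u] = -lam.d x ![u, v] := ContinuousAlternatingMap.pair_swap
        (X := EuclideanSpace ℝ (Fin 3)) (lam.d x) v u
      linarith
    have h2 := hσ x v u ⟨hv, hu, lam, hlam, h1⟩
    have h3 := hσ x u v huv
    have h4 := ContinuousAlternatingMap.pair_swap (X := EuclideanSpace ℝ (Fin 4)) (σ (ι x))
      (mfderiv (𝓡 3) (𝓡∂ 4) ι x u) (mfderiv (𝓡 3) (𝓡∂ 4) ι x v)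
    exact absurd (h3.trans_eq h4) (not_lt.2 (neg_nonpos.2 h2.le))
  · exfalso
    let A : EuclideanSpace ℝ (Fin 3) [⋀^Fin 1]→L[ℝ] ℝ := lam x
    let A' : EuclideanSpace ℝ (Fin 3) [⋀^Fin 1]→L[ℝ] ℝ := lam' x
    let B : EuclideanSpace ℝ (Fin 3) [⋀^Fin 2]→L[ℝ] ℝ := lam.d x
    let B' : EuclideanSpace ℝ (Fin 3) [⋀^Fin 2]→L[ℝ] ℝ := lam'.d x
    obtain ⟨a, b, c, habc⟩ := hlam.1.nondegenerate x
    obtain ⟨a', b', c', habc'⟩ := hlam'.1.nondegenerate x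
    have hne : wedgeOneTwo A B ![a, b, c] ≠ 0 := habc
    have hne' : wedgeOneTwo A' B' ![a', b', c'] ≠ 0 := habc'
    obtain ⟨R, -, -, hR, -⟩ := exists_frame_of_wedgeOneTwo_ne_zero hne'
    have e1 : wedgeOneTwo A' B' ![R, u, v] ≠ 0 := by
      have hu' : A' ![u] = 0 := (hlam'.2.1 x u).1 hu
      have hv' : A' ![v] = 0 := (hlam'.2.1 x v).1 hv
      have hB' : 0 < B' ![u, v] := hpos
      rw [wedgeOneTwo_apply]
      change A' ![R] * B' ![u, v] - A' ![u] * B' ![R, v] + A' ![v] * B' ![R, u] ≠ 0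
      rw [hu', hv']
      have := mul_pos hR hB'
      simpa using this.ne'
    have e2 : wedgeOneTwo A B ![R, u, v] = 0 := by
      have hu' : A ![u] = 0 := (hlam.2.1 x u).1 hu
      have hv' : A ![v] = 0 := (hlam.2.1 x v).1 hv
      have hB' : B ![u, v] = 0 := h
      rw [wedgeOneTwo_apply]
      change A ![R] * B ![u, v] - A ![u] * B ![R, v] + A ![v] * B ![R, u] = 0
      rw [hu', hv', hB']
      ring
    obtain ⟨b, hb⟩ := AlternatingMap.exists_basis_of_ne_zero (by simp) (wedgeOneTwo A' B') e1
    rw [← hb] at e2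
    rw [(wedgeOneTwo A B).eq_smul_basis_det b, e2, zero_smul] at hne
    exact hne rfl
  · exact h

variable [IsManifold (𝓡∂ 4) ∞ W] [IsManifold (𝓡 3) ∞ V]

theorem exists_isOutward (p : W) : ∃ n : TangentSpace (𝓡∂ 4) p, IsOutward p n := by
  let n : EuclideanSpace ℝ (Fin 4) := EuclideanSpace.single 0 (-1)
  have hn : (EuclideanSpace.proj 0 : EuclideanSpace ℝ (Fin 4) →L[ℝ] ℝ) n < 0 := by simp [n]
  exact ⟨n, isOutward_iff.2 hn⟩

theorem IsWeakFilling.exists_hasFrameBound {ξ : ContactStructure V} {ι : V → W}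
    {σ : DForm (𝓡∂ 4) W 2} (hσ : IsWeakFilling σ ι ξ) {lam : DForm (𝓡 3) V 1}
    (hlam : ξ.IsDefinedBy lam) {μ α : DForm (𝓡∂ 4) W 1} (hμ : ∀ p, μ.SmoothAt p)
    (hμι : ∀ x, DForm.pullback (I := 𝓡 3) ι μ x = lam x) {ρ : W → ℝ}
    (hρ : ContMDiff (𝓡∂ 4) 𝓘(ℝ, ℝ) ∞ ρ) (hρ₀ : ∀ p, ρ p = 0 ↔ p ∈ (𝓡∂ 4).boundary W)
    (hρ' : ∀ p ∈ (𝓡∂ 4).boundary W, ∀ n : TangentSpace (𝓡∂ 4) p, IsOutward p n →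
        (DForm.ofFun (I := 𝓡∂ 4) ρ).d p ![n] < 0)
    {p : W} (hp : p ∈ (𝓡∂ 4).boundary W) (hα : α.SmoothAt p) :
    ∃ c B : ℝ, 0 < c ∧
      ∀ᶠ q in 𝓝 p, HasFrameBound σ μ.d (DForm.ofFun (I := 𝓡∂ 4) ρ).d μ α c B q := by
  have hp' := hp
  rw [← hσ.boundary.range_eq] at hp'
  obtain ⟨x, rfl⟩ := hp'
  obtain ⟨n, hn⟩ := exists_isOutward (ι x)
  obtain ⟨a, b, c, habc⟩ := hlam.1.nondegenerate x
  have hframe : ∃ R u v : TangentSpace (𝓡 3) x, 0 < lam x ![R] ∧ lam x ![u] = 0 ∧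
      lam x ![v] = 0 ∧ 0 < lam.d x ![u, v] := exists_frame_of_wedgeOneTwo_ne_zero
    (X := EuclideanSpace ℝ (Fin 3)) (A := lam x) (B := lam.d x) (v := ![a, b, c]) habc
  obtain ⟨R, u, v, hR, hu, hv, huv⟩ := hframe
  have hι : ContMDiffAt (𝓡 3) (𝓡∂ 4) ∞ ι x := hσ.boundary.smooth.contMDiffAt
  have hμ1 : ∀ w : TangentSpace (𝓡 3) x, μ (ι x) ![mfderiv (𝓡 3) (𝓡∂ 4) ι x w] = lam x ![w] :=
    fun w => by rw [← DForm.pullback_apply_one, hμι]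
  have hμ2 : ∀ w w' : TangentSpace (𝓡 3) x, μ.d (ι x) ![mfderiv (𝓡 3) (𝓡∂ 4) ι x w,
      mfderiv (𝓡 3) (𝓡∂ 4) ι x w'] = lam.d x ![w, w'] := fun w w' => by
    rw [← DForm.pullback_apply_two, ← DForm.d_pullback (hμ _) hι, funext hμι]
  have hρι : ∀ w : TangentSpace (𝓡 3) x,
      (DForm.ofFun (I := 𝓡∂ 4) ρ).d (ι x) ![mfderiv (𝓡 3) (𝓡∂ 4) ι x w] = 0 := fun w => by
    have : (fun y => ρ (ι y)) = fun _ => 0 := funext fun y => (hρ₀ _).2 (by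
      rw [← hσ.boundary.range_eq]; exact mem_range_self y)
    rw [DForm.d_ofFun_comp_map hι hρ.contMDiffAt, this, DForm.d_ofFun_const]
  have hrn := hρ' _ hp n hn
  have hpos : 0 < σ (ι x) ![mfderiv (𝓡 3) (𝓡∂ 4) ι x u, mfderiv (𝓡 3) (𝓡∂ 4) ι x v] :=
    hσ.positive x u v ⟨(hlam.2.1 x u).2 hu, (hlam.2.1 x v).2 hv, lam, hlam, huv⟩
  have hwedge := hσ.orientation x n R u v hn ⟨lam, hlam, by
    have := mul_pos hR huv
    simpa [wedge12, hu, hv] using this⟩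
  have hmR : 0 < μ (ι x) ![mfderiv (𝓡 3) (𝓡∂ 4) ι x R] := by rw [hμ1]; exact hR
  have hmu : μ (ι x) ![mfderiv (𝓡 3) (𝓡∂ 4) ι x u] = 0 := by rw [hμ1]; exact hu
  have hmv : μ (ι x) ![mfderiv (𝓡 3) (𝓡∂ 4) ι x v] = 0 := by rw [hμ1]; exact hv
  have hlpos : 0 < μ.d (ι x) ![mfderiv (𝓡 3) (𝓡∂ 4) ι x u, mfderiv (𝓡 3) (𝓡∂ 4) ι x v] := by
    rw [hμ2]; exact huv
  refine exists_eventually_hasFrameBound ((DForm.smooth_iff.1 hσ.symplectic.smooth) _)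
    (DForm.SmoothAt.d (Filter.Eventually.of_forall hμ))
    (DForm.SmoothAt.d (Filter.Eventually.of_forall fun q =>
      DForm.smoothAt_ofFun hρ.contMDiffAt)) (hμ _) hα
    ![n, mfderiv (𝓡 3) (𝓡∂ 4) ι x R, mfderiv (𝓡 3) (𝓡∂ 4) ι x u, mfderiv (𝓡 3) (𝓡∂ 4) ι x v]
    ?_ ?_ ?_
  · rw [wedgeSq] at hwedge
    exact pos_of_mul_pos_right hwedge two_pos.le
  · simp only [pfPair, wedgeMatrix, Matrix.cons_val_zero, Matrix.cons_val_one, Matrix.cons_val,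
      hρι, hmu, hmv]
    have := mul_pos (mul_pos (neg_pos.2 hrn) hmR) hpos
    linarith
  · simp only [pfPair, wedgeMatrix, Matrix.cons_val_zero, Matrix.cons_val_one, Matrix.cons_val,
      hρι, hmu, hmv]
    have := mul_pos (mul_pos (neg_pos.2 hrn) hmR) hlpos
    linarith

end Filling

/-- The 1-form `f (C μ - α)`, which interpolates between `0` and the difference of the primitives
`C μ` and `α`. -/
def cutoffForm (f : M → ℝ) (C : ℝ) (μ α : DForm I M 1) : DForm I M 1 := fun q =>
  f q • (C • μ q + (-1 : ℝ) • α q)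

theorem cutoffForm_smoothAt {f : M → ℝ} {C : ℝ} {μ α : DForm I M 1} {q : M}
    (hf : ContMDiffAt I 𝓘(ℝ, ℝ) ∞ f q) (hμ : μ.SmoothAt q) (hα : α.SmoothAt q) :
    (cutoffForm f C μ α).SmoothAt q :=
  DForm.SmoothAt.smul hf ((hμ.const_smul C).add (hα.const_smul (-1)))

theorem d_cutoffForm_apply [IsManifold I ∞ M] {φ : ℝ → ℝ} {ρ : M → ℝ} {C : ℝ} {μ α : DForm I M 1}
    {q : M} (hφ : ContDiff ℝ ∞ φ) (hρ : ContMDiffAt I 𝓘(ℝ, ℝ) ∞ ρ q) (hμ : μ.SmoothAt q)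
    (hα : α.SmoothAt q) (v w : TangentSpace I q) :
    (cutoffForm (fun p => φ (ρ p)) C μ α).d q ![v, w] =
      φ (ρ q) * (C * μ.d q ![v, w] - α.d q ![v, w]) - -deriv φ (ρ q) *
        ((DForm.ofFun (I := I) ρ).d q ![v] * (C * μ q ![w] - α q ![w]) -
          (DForm.ofFun (I := I) ρ).d q ![w] * (C * μ q ![v] - α q ![v])) := by
  have hf : ContMDiffAt I 𝓘(ℝ, ℝ) ∞ (fun p => φ (ρ p)) q :=
    hφ.contMDiff.contMDiffAt.comp q hρ
  have h1 := DForm.d_smul_apply hf ((hμ.const_smul C).add (hα.const_smul (-1))) v w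
  have h2 : ∀ u, (DForm.ofFun (I := I) fun p => φ (ρ p)).d q ![u] =
      deriv φ (ρ q) * (DForm.ofFun (I := I) ρ).d q ![u] := fun u =>
    DForm.d_ofFun_comp_apply (hφ.differentiable (by simp) _) (hρ.mdifferentiableAt (by simp)) u
  rw [DForm.d_add (hμ.const_smul C) (hα.const_smul (-1)), DForm.d_const_smul, DForm.d_const_smul,
    h2, h2] at h1
  refine h1.trans ?_
  simp only [ContinuousAlternatingMap.add_apply, ContinuousAlternatingMap.smul_apply, smul_eq_mul]
  ring

theorem HasFrameBound.exists_pfaffian_pos [IsManifold I ∞ M] {σ : DForm I M 2} {μ α : DForm I M 1}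
    {ρ φ : _} {c B C K : ℝ} {q : M}
    (h : HasFrameBound σ μ.d (DForm.ofFun (I := I) ρ).d μ α c B q)
    (hφ : ContDiff ℝ ∞ φ) (hρ : ContMDiffAt I 𝓘(ℝ, ℝ) ∞ ρ q) (hμ : μ.SmoothAt q)
    (hα : α.SmoothAt q) (hασ : α.d q = σ q) (hf₀ : 0 ≤ φ (ρ q)) (hf₁ : φ (ρ q) ≤ 1)
    (hk : K * φ (ρ q) ≤ -deriv φ (ρ q)) (hK : 0 < K)
    (hc : 0 < c) (hC : 0 < C) (hKc : 2 * B ≤ K * c) (hCc : 2 * B + 2 ≤ C * c) :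
    ∃ e : Fin 4 → E, 0 < pfaffian (X := E) (σ q) e ∧
      0 < pfaffian (X := E) (σ q + (cutoffForm (fun p => φ (ρ p)) C μ α).d q) e := by
  obtain ⟨e, he⟩ := h
  refine ⟨e, he.pos, ?_⟩
  have h1 := he.pf_pos hf₀ hf₁ hk hK hc hC hKc hCc
  have h2 : ∀ i j, (σ q + (cutoffForm (fun p => φ (ρ p)) C μ α).d q) ![e i, e j] =
      σ q ![e i, e j] + φ (ρ q) * (C * μ.d q ![e i, e j] - σ q ![e i, e j]) - -deriv φ (ρ q) *
        ((DForm.ofFun (I := I) ρ).d q ![e i] * (C * μ q ![e j] - α q ![e j]) -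
          (DForm.ofFun (I := I) ρ).d q ![e j] * (C * μ q ![e i] - α q ![e i])) := fun i j => by
    rw [ContinuousAlternatingMap.add_apply, d_cutoffForm_apply hφ hρ hμ hα, hασ]
    ring
  refine h1.trans_eq ?_
  simp only [← h2]
  rfl

theorem IsSymplecticForm.add_d [IsManifold I ∞ M] {σ : DForm I M 2} {η : DForm I M 1}
    (hσ : IsSymplecticForm σ) (hη : ∀ q, η.SmoothAt q) (hE : Module.finrank ℝ E = 4)
    (h : ∀ q, η.d q = 0 ∨ ∃ e : Fin 4 → E, 0 < pfaffian (X := E) (σ q + η.d q) e) :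
    IsSymplecticForm (I := I) (M := M) fun q => σ q + η.d q where
  smooth := DForm.smooth_iff.2 fun q => (DForm.smooth_iff.1 hσ.smooth q).add
    (DForm.SmoothAt.d (Filter.Eventually.of_forall hη))
  closed q := by
    rw [DForm.d_add (DForm.smooth_iff.1 hσ.smooth q)
      (DForm.SmoothAt.d (Filter.Eventually.of_forall hη)),
      DForm.d_d (Filter.Eventually.of_forall hη), hσ.closed, add_zero]
  nondegenerate q v hv := by
    rcases h q with h | ⟨e, he⟩
    · refine hσ.nondegenerate q v fun w => ?_
      have := hv w
      rwa [h, add_zero] at this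
    · exact eq_zero_of_pfaffian_ne_zero (X := E) hE he.ne' hv

theorem IsCompact.exists_pos_forall_le_imp_mem [CompactSpace M] {ρ : M → ℝ} (hρ : Continuous ρ)
    (hρ₀ : ∀ p, 0 ≤ ρ p) {G : Set M} (hG : IsOpen G) (h : ∀ p, ρ p = 0 → p ∈ G) :
    ∃ δ : ℝ, 0 < δ ∧ ∀ p, ρ p ≤ δ → p ∈ G := by
  rcases Gᶜ.eq_empty_or_nonempty with he | hne
  · exact ⟨1, one_pos, fun p _ => by rw [compl_empty_iff.1 he]; trivial⟩
  · obtain ⟨p₀, hp₀, hmin⟩ := hG.isClosed_compl.isCompact.exists_isMinOn hne hρ.continuousOn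
    have h0 : 0 < ρ p₀ := (hρ₀ p₀).lt_of_ne fun h0 => hp₀ (h p₀ h0.symm)
    refine ⟨ρ p₀ / 2, half_pos h0, fun p hp => by_contra fun hpG => ?_⟩
    have := isMinOn_iff.1 hmin p hpG
    linarith

section Filling

variable {W : Type*} [TopologicalSpace W] [ChartedSpace (EuclideanHalfSpace 4) W]
  {V : Type*} [TopologicalSpace V] [ChartedSpace (EuclideanSpace ℝ (Fin 3)) V]

theorem OrientationsAgree.of_pfaffian_pos {σ σ' : DForm (𝓡∂ 4) W 2} {ι : V → W}
    {ξ : ContactStructure V} (h : OrientationsAgree σ ι ξ)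
    (hσ' : ∀ x, ∃ e : Fin 4 → EuclideanSpace ℝ (Fin 4),
      0 < pfaffian (X := EuclideanSpace ℝ (Fin 4)) (σ (ι x)) e ∧
      0 < pfaffian (X := EuclideanSpace ℝ (Fin 4)) (σ' (ι x)) e) :
    OrientationsAgree σ' ι ξ := by
  intro x n a b c hn habc
  obtain ⟨e, he, he'⟩ := hσ' x
  have h1 := h x n a b c hn habc
  rw [wedgeSq] at h1 ⊢
  refine mul_pos two_pos ?_
  exact AlternatingMap.pos_of_pos (X := EuclideanSpace ℝ (Fin 4)) (by simp) he he'
    (u := ![n, mfderiv (𝓡 3) (𝓡∂ 4) ι x a, mfderiv (𝓡 3) (𝓡∂ 4) ι x b,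
      mfderiv (𝓡 3) (𝓡∂ 4) ι x c]) (pos_of_mul_pos_right h1 two_pos.le)

variable [IsManifold (𝓡∂ 4) ∞ W] [IsManifold (𝓡 3) ∞ V]

/-- A primitive that restricts to a positive multiple of a contact form makes a strong filling. -/
theorem IsStrongFilling.of_pullback_eq {σ : DForm (𝓡∂ 4) W 2} {ι : V → W} {ξ : ContactStructure V}
    (hσ : IsSymplecticForm σ) (hι : IsBoundaryInclusion ι) (ho : OrientationsAgree σ ι ξ)
    {lam : DForm (𝓡 3) V 1} (hlam : ξ.IsDefinedBy lam)
    (hpos : ∀ (x : V) (u v : TangentSpace (𝓡 3) x), ξ.PosFrame x u v → 0 < lam.d x ![u, v])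
    {G : Set W} (hG : IsOpen G) (hbG : (𝓡∂ 4).boundary W ⊆ G) {α : DForm (𝓡∂ 4) W 1}
    (hα : IsPrimitiveOn α σ G) {C : ℝ} (hC : 0 < C)
    (hαι : ∀ x, DForm.pullback (I := 𝓡 3) ι α x = C • lam x) : IsStrongFilling σ ι ξ where
  symplectic := hσ
  boundary := hι
  orientation := ho
  primitive := by
    refine ⟨G, hG, hbG, α, hα, fun x v => ?_, fun x u v huv => ?_⟩
    · rw [← DForm.pullback_apply_one, hαι, ContinuousAlternatingMap.smul_apply, smul_eq_mul,
        mul_eq_zero, or_iff_right hC.ne', hlam.2.1]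
    · have hx : ι x ∈ G := hbG (by rw [← hι.range_eq]; exact mem_range_self x)
      rw [← DForm.pullback_apply_two, ← DForm.d_pullback ((DForm.smoothOn_iff hG).1 hα.1 _ hx)
        hι.smooth.contMDiffAt, funext hαι, DForm.d_const_smul, ContinuousAlternatingMap.smul_apply,
        smul_eq_mul]
      exact mul_pos hC (hpos x u v huv)

theorem IsWeakFilling.exists_isStrongFilling [T2Space W] [CompactSpace W] {ξ : ContactStructure V}
    {ι : V → W} {σ : DForm (𝓡∂ 4) W 2} (hσ : IsWeakFilling σ ι ξ) (hexact : ExactNearBoundary σ)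
    {U : Set W} (hU : IsOpen U) (hbU : (𝓡∂ 4).boundary W ⊆ U) :
    ∃ σ' : DForm (𝓡∂ 4) W 2, IsStrongFilling σ' ι ξ ∧ ∀ p : W, p ∉ U → σ' p = σ p := by
  obtain ⟨lam, hlam⟩ : ∃ lam, ξ.IsDefinedBy lam := ξ.exists_form
  obtain ⟨Uα, hUα, hbα, α, hα, hασ⟩ := hexact
  rw [DForm.smoothOn_iff hUα] at hα
  obtain ⟨μ, hμ, hμι⟩ := hσ.boundary.exists_extension hlam.1.smooth
  obtain ⟨ρ, hρ, hρ₀, hρb, hρ'⟩ := exists_boundary_function (W := W)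
  have hcl : IsClosed ((𝓡∂ 4).boundary W) := (𝓡∂ 4).isClosed_boundary (n := ∞) (by simp)
  obtain ⟨c, B, hc, O, hO, hbO, hbound⟩ := IsCompact.exists_hasFrameBound hcl.isCompact fun p hp =>
    hσ.exists_hasFrameBound hlam hμ hμι hρ hρb hρ' hp (hα p (hbα hp))
  obtain ⟨δ₀, hδ₀, hδG⟩ := IsCompact.exists_pos_forall_le_imp_mem hρ.continuous hρ₀
    ((hO.inter hU).inter hUα) fun p hp =>
      ⟨⟨hbO ((hρb p).1 hp), hbU ((hρb p).1 hp)⟩, hbα ((hρb p).1 hp)⟩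
  set G := O ∩ U ∩ Uα with hGdef
  have hG : IsOpen G := (hO.inter hU).inter hUα
  have hbG : (𝓡∂ 4).boundary W ⊆ G := fun p hp => ⟨⟨hbO hp, hbU hp⟩, hbα hp⟩
  obtain ⟨K, hK₁, hKc⟩ : ∃ K : ℝ, 1 ≤ K ∧ 2 * B ≤ K * c := by
    refine ⟨max 1 (2 * B / c), le_max_left _ _, ?_⟩
    rw [← div_le_iff₀ hc]
    exact le_max_right _ _
  obtain ⟨C, hC₁, hCc⟩ : ∃ C : ℝ, 1 ≤ C ∧ 2 * B + 2 ≤ C * c := by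
    refine ⟨max 1 ((2 * B + 2) / c), le_max_left _ _, ?_⟩
    rw [← div_le_iff₀ hc]
    exact le_max_right _ _
  have hK : 0 < K := one_pos.trans_le hK₁
  have hC : 0 < C := one_pos.trans_le hC₁
  obtain ⟨δ, hδ, hδδ₀, hKδ⟩ : ∃ δ : ℝ, 0 < δ ∧ δ < δ₀ ∧ K * δ ^ 2 ≤ 1 := by
    refine ⟨min (δ₀ / 2) K⁻¹, lt_min (half_pos hδ₀) (inv_pos.2 hK),
      (min_le_left _ _).trans_lt (half_lt_self hδ₀), ?_⟩
    have h1 : min (δ₀ / 2) K⁻¹ ≤ K⁻¹ := min_le_right _ _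
    have h0 : 0 < min (δ₀ / 2) K⁻¹ := lt_min (half_pos hδ₀) (inv_pos.2 hK)
    calc K * min (δ₀ / 2) K⁻¹ ^ 2 ≤ K * K⁻¹ ^ 2 := by gcongr
      _ = K⁻¹ := by field_simp
      _ ≤ 1 := inv_le_one_of_one_le₀ hK₁
  obtain ⟨φ, hφ, hφ0, hφnn, hφ1, hφδ, hφK⟩ := exists_steep_cutoff hδ hKδ
  have hf : ContMDiff (𝓡∂ 4) 𝓘(ℝ, ℝ) ∞ fun p => φ (ρ p) := hφ.contMDiff.comp hρ
  set η := cutoffForm (fun p => φ (ρ p)) C μ α with hη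
  have hout : ∀ q, q ∉ G → ∀ᶠ p in 𝓝 q, 0 = η p := fun q hq => by
    have h1 : δ < ρ q := hδδ₀.trans (not_le.1 fun h => hq (hδG q h))
    filter_upwards [hρ.continuous.continuousAt.eventually (lt_mem_nhds h1)] with p hp
    simp only [hη, cutoffForm, hφδ _ hp.le, zero_smul]
  have hηs : ∀ q, η.SmoothAt q := fun q => by
    by_cases hq : q ∈ G
    · exact cutoffForm_smoothAt hf.contMDiffAt (hμ q) (hα q hq.2)
    · exact (DForm.smoothAt_zero q).congr (hout q hq)
  have hηd : ∀ q, q ∉ G → η.d q = 0 := fun q hq => by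
    rw [← DForm.d_congr (hout q hq), DForm.d_zero]
  have hpf : ∀ q ∈ G, ∃ e : Fin 4 → EuclideanSpace ℝ (Fin 4),
      0 < pfaffian (X := EuclideanSpace ℝ (Fin 4)) (σ q) e ∧
      0 < pfaffian (X := EuclideanSpace ℝ (Fin 4)) (σ q + η.d q) e := fun q hq =>
    (hbound q hq.1.1).exists_pfaffian_pos hφ hρ.contMDiffAt (hμ q) (hα q hq.2) (hασ q hq.2)
      (hφnn _) (hφ1 _ (hρ₀ q)) (hφK _ (hρ₀ q)) hK hc hC hKc hCc
  have hιb : ∀ x, ι x ∈ (𝓡∂ 4).boundary W := fun x => by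
    rw [← hσ.boundary.range_eq]; exact mem_range_self x
  refine ⟨fun q => σ q + η.d q, ?_, fun q hq => ?_⟩
  · refine IsStrongFilling.of_pullback_eq (α := fun q => α q + η q) (C := C)
      (hσ.symplectic.add_d hηs (by simp) fun q => ?_) hσ.boundary
      (hσ.orientation.of_pfaffian_pos fun x => hpf _ (hbG (hιb x))) hlam
      (fun x u v huv => hlam.d_pos hσ.positive huv) hG hbG ⟨?_, fun q hq => ?_⟩ hC fun x => ?_
    · by_cases hq : q ∈ G
      · obtain ⟨e, -, he⟩ := hpf q hq
        exact .inr ⟨e, he⟩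
      · exact .inl (hηd q hq)
    · exact (DForm.smoothOn_iff hG).2 fun q hq => (hα q hq.2).add (hηs q)
    · rw [DForm.d_add (hα q hq.2) (hηs q), hασ q hq.2]
    · rw [← hμι]
      have h1 : α (ι x) + η (ι x) = C • μ (ι x) := by
        ext v
        simp only [hη, cutoffForm, (hρb _).2 (hιb x), hφ0, ContinuousAlternatingMap.add_apply,
          ContinuousAlternatingMap.smul_apply, smul_eq_mul]
        ring
      ext v
      rw [DForm.pullback_apply, h1]
      rfl
  · simp only [hηd q fun h => hq h.1.2, add_zero]

end Filling

end FormCalculus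

end SymplecticFilling

end

theorem mainTheorem6
    {W : Type*} [TopologicalSpace W] [ChartedSpace (EuclideanHalfSpace 4) W]
    [IsManifold (𝓡∂ 4) ∞ W] [T2Space W] [CompactSpace W]
    {V : Type*} [TopologicalSpace V] [ChartedSpace (EuclideanSpace ℝ (Fin 3)) V]
    [IsManifold (𝓡 3) ∞ V]
    (ξ : SymplecticFilling.ContactStructure V) (ι : V → W)
    (σ : SymplecticFilling.DForm (𝓡∂ 4) W 2)
    (hweak : SymplecticFilling.IsWeakFilling σ ι ξ)
    (hexact : SymplecticFilling.ExactNearBoundary σ)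
    (U : Set W) (hU : IsOpen U) (hbU : (𝓡∂ 4).boundary W ⊆ U) :
    ∃ σ' : SymplecticFilling.DForm (𝓡∂ 4) W 2,
      SymplecticFilling.IsStrongFilling σ' ι ξ ∧ ∀ p : W, p ∉ U → σ' p = σ p :=
  hweak.exists_isStrongFilling hexact hU hbU
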